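/- **Definitions.** For a finite-dimensional real Lie algebra $L$, the coadjoint orbit of $\xi\in L^*$ is its orbit under a connected Lie group with Lie algebra $L$, i.e. under the subgroup of $GL(L^*)$ generated by the exponentials of the operators $\langle x\cdot\xi,y\rangle=-\langle\xi,[x,y]\rangle$ $(x\in L)$. For a finite-dimensional real representation $V$ of a finite-dimensional real Lie algebra $\mathfrak g$, let $\mathfrak g\ltimes V$ be the Lie algebra $\mathfrak g\oplus V$ with bracket $[(X,u),(X',u')]=([X,X'],Xu'-X'u)$, so that $(\mathfrak g\ltimes V)^*=\mathfrak g^*\oplus V^*$. Let a set $\Omega\subseteq\mathfrak g^*$ of generic points be given. For a polynomial map $\phi:\mathfrak g^*\to V^*$ put $\Phi(\xi)=\xi+\phi(\xi)$. The pair $(\mathfrak g\ltimes V,\phi)$ is an *overalgebra of $\mathfrak g$ almost separating of degree $p$* if 1. $\phi$ is polynomial of degree $p$ (not necessarily homogeneous; the zero map counts as having degree $0$); 2. for every $\xi\in\mathfrak g^*$, $\Phi$ maps the coadjoint orbit of $\xi$ onto the coadjoint orbit of $\Phi(\xi)$ in $(\mathfrak g\ltimes V)^*$; 3. for every $\xi\in\Omega$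 there are only finitely many coadjoint orbits $\mathcal O'$ in $\mathfrak g^*$ such that $\Phi(\mathcal O')$ and $\Phi(\mathcal O_\xi)$ have the same closed convex hull, where $\mathcal O_\xi$ is the coadjoint orbit of $\xi$. Let $S^k(\mathfrak g)$ be the $k$-th symmetric power of the adjoint representation, $S_p(\mathfrak g)=\mathfrak g\oplus S^2(\mathfrak g)\oplus\dots\oplus S^p(\mathfrak g)$, and $\tau(x)=x+x\cdot x+\dots+x^{p}\in S_p(\mathfrak g)$ for $x\in\mathfrak g$. An intertwining map is a linear map commuting with the action of $\mathfrak g$. **Statement.** (a) Let $\mathfrak g$ be a split semisimple real Lie algebra. Identify $\mathfrak g^*$ with $\mathfrak g$ by the Killing form and let $\Omega$ be the set of regular elements. If $\mathfrak g$ admits an overalgebra almost separating of degree $p$, then there is an intertwining map $b:S_p(\mathfrak g)\to S_p(\mathfrak g)$ such that $(\mathfrak g\ltimes S_p(\mathfrak g)^*,\,b\circ\tau)$ is an overalgebra of $\mathfrak g$ almost separating of degree $p$; here $b\circ\tau:\mathfrak g^*\simeq\mathfrak g\to S_p(\mathfrak g)=(S_p(\mathfrak g)^*)^*$. (b) Let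 $\mathfrak g=\mathfrak{sl}(n,\mathbb R)$. Identify $\mathfrak g^*$ with $\mathfrak g$ by the form $\mathrm{Tr}(XY)$ and let $\Omega$ be the set of matrices with $n$ distinct complex eigenvalues. Every $S^k(\mathfrak g)$ is self-dual, i.e. isomorphic to $S^k(\mathfrak g)^*$ as a $\mathfrak g$-module. If $\mathfrak g$ admits an overalgebra almost separating of degree $p$, then for every choice of $\mathfrak g$-module isomorphisms $S^k(\mathfrak g)\simeq S^k(\mathfrak g)^*$ $(1\le k\le p)$, used to identify $S_p(\mathfrak g)$ with $S_p(\mathfrak g)^*$, there are intertwining maps $b_k:S^k(\mathfrak g)\to S^k(\mathfrak g)$ $(1\le k\le p)$ such that $(\mathfrak g\ltimes S_p(\mathfrak g),\,\sum_k b_k\circ\tau)$ is an overalgebra of $\mathfrak g$ almost separating of degree $p$, where $\big(\sum_k b_k\circ\tau\big)(x)=\sum_{k=1}^p b_k(x^k)\in S_p(\mathfrak g)=S_p(\mathfrak g)^*$. -/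

import Mathlib

open scoped DirectSum

noncomputable section

/-! ### Coadjoint orbits -/

/-- The exponential `∑ Aⁿ / n!` of an endomorphism of a real vector space, the sum being taken in
the canonical topology of the space of endomorphisms (for a finite-dimensional space: its unique
Hausdorff vector space topology). -/
def expEnd {E : Type*} [AddCommGroup E] [Module ℝ E] (A : Module.End ℝ E) : Module.End ℝ E :=
  letI : TopologicalSpace (Module.End ℝ E) := moduleTopology ℝ (Module.End ℝ E)
  ∑' n : ℕ, ((n.factorial : ℝ)⁻¹) • A ^ n

/-- For a representation of a real Lie algebra `L` on `M`, the subgroup of `GL(M)` generated by the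
exponentials of the operators of `L`. It is the image in `GL(M)` of every connected Lie group with
Lie algebra `L` to which the representation integrates. -/
def integratedGroup (L M : Type*) [LieRing L] [LieAlgebra ℝ L] [AddCommGroup M] [Module ℝ M]
    [LieRingModule L M] [LieModule ℝ L M] : Subgroup (Module.End ℝ M)ˣ :=
  Subgroup.closure {u | ∃ x : L, (u : Module.End ℝ M) = expEnd (LieModule.toEnd ℝ L M x)}

/-- The coadjoint orbit of `ξ ∈ L*` under a connected Lie group with Lie algebra `L`; on `L*` the
Lie algebra acts by `⟨x ⬝ ξ, y⟩ = -⟨ξ, [x, y]⟩`. -/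
def coadjointOrbit (L : Type*) [LieRing L] [LieAlgebra ℝ L] (ξ : Module.Dual ℝ L) :
    Set (Module.Dual ℝ L) :=
  {η | ∃ u ∈ integratedGroup L (Module.Dual ℝ L), (u : Module.End ℝ (Module.Dual ℝ L)) ξ = η}

/-- The closed convex hull of a subset of a (finite-dimensional) real vector space, closure being
taken in the canonical topology. -/
def closedConvHull {E : Type*} [AddCommGroup E] [Module ℝ E] (s : Set E) : Set E :=
  @closure E (moduleTopology ℝ E) (convexHull ℝ s)

/-! ### The semidirect product of a Lie algebra and a representation -/

/-- The vector space `g ⊕ V` underlying the semidirect product `g ⋉ V`. -/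
def Semidirect (g V : Type*) : Type _ := g × V

namespace Semidirect

variable {g V : Type*} [LieRing g] [LieAlgebra ℝ g] [AddCommGroup V] [Module ℝ V]
  [LieRingModule g V] [LieModule ℝ g V]

instance : AddCommGroup (Semidirect g V) := inferInstanceAs (AddCommGroup (g × V))

instance : Module ℝ (Semidirect g V) := inferInstanceAs (Module ℝ (g × V))

/-- `[(X, u), (X', u')] = ([X, X'], X u' - X' u)`. -/
instance : Bracket (Semidirect g V) (Semidirect g V) :=
  ⟨fun a b => ((⁅a.1, b.1⁆, ⁅a.1, b.2⁆ - ⁅b.1, a.2⁆) : g × V)⟩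

instance : LieRing (Semidirect g V) where
  add_lie a b c := by
    refine Prod.ext (add_lie a.1 b.1 c.1) ?_
    change ⁅a.1 + b.1, c.2⁆ - ⁅c.1, a.2 + b.2⁆ = ⁅a.1, c.2⁆ - ⁅c.1, a.2⁆ + (⁅b.1, c.2⁆ - ⁅c.1, b.2⁆)
    rw [add_lie, lie_add]
    abel
  lie_add a b c := by
    refine Prod.ext (lie_add a.1 b.1 c.1) ?_
    change ⁅a.1, b.2 + c.2⁆ - ⁅b.1 + c.1, a.2⁆ = ⁅a.1, b.2⁆ - ⁅b.1, a.2⁆ + (⁅a.1, c.2⁆ - ⁅c.1, a.2⁆)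
    rw [add_lie, lie_add]
    abel
  lie_self a := Prod.ext (lie_self a.1) (sub_self _)
  leibniz_lie a b c := by
    refine Prod.ext (leibniz_lie a.1 b.1 c.1) ?_
    change ⁅a.1, ⁅b.1, c.2⁆ - ⁅c.1, b.2⁆⁆ - ⁅⁅b.1, c.1⁆, a.2⁆ =
      ⁅⁅a.1, b.1⁆, c.2⁆ - ⁅c.1, ⁅a.1, b.2⁆ - ⁅b.1, a.2⁆⁆ +
        (⁅b.1, ⁅a.1, c.2⁆ - ⁅c.1, a.2⁆⁆ - ⁅⁅a.1, c.1⁆, b.2⁆)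
    simp only [lie_sub, lie_lie]
    abel

instance : LieAlgebra ℝ (Semidirect g V) where
  lie_smul t a b := by
    refine Prod.ext (lie_smul t a.1 b.1) ?_
    change ⁅a.1, t • b.2⁆ - ⁅t • b.1, a.2⁆ = t • (⁅a.1, b.2⁆ - ⁅b.1, a.2⁆)
    rw [smul_lie, lie_smul, smul_sub]

end Semidirect

/-- The map `Φ(ξ) = ξ + φ(ξ)` from `g*` to `(g ⋉ V)* = g* ⊕ V*`. -/
def overMap {g V : Type*} [LieRing g] [LieAlgebra ℝ g] [AddCommGroup V] [Module ℝ V]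
    [LieRingModule g V] [LieModule ℝ g V] (φ : Module.Dual ℝ g → Module.Dual ℝ V)
    (ξ : Module.Dual ℝ g) : Module.Dual ℝ (Semidirect g V) :=
  (LinearMap.coprod ξ (φ ξ) : g × V →ₗ[ℝ] ℝ)

/-! ### Polynomial maps -/

/-- `f` is polynomial of degree at most `d`: a sum of homogeneous polynomial maps
`x ↦ m k (x, …, x)` of degrees `k ≤ d`, with `m k` a `k`-linear map. -/
def IsPolynomialOfDegreeLE {E F : Type*} [AddCommGroup E] [Module ℝ E] [AddCommGroup F] [Module ℝ F]
    (f : E → F) (d : ℕ) : Prop :=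
  ∃ m : (k : ℕ) → MultilinearMap ℝ (fun _ : Fin k => E) F,
    ∀ x, f x = ∑ k ∈ Finset.range (d + 1), m k (fun _ => x)

/-- `f` is polynomial of degree exactly `d` (the zero map counts as having degree `0`). -/
def IsPolynomialOfDegree {E F : Type*} [AddCommGroup E] [Module ℝ E] [AddCommGroup F] [Module ℝ F]
    (f : E → F) (d : ℕ) : Prop :=
  IsLeast {e | IsPolynomialOfDegreeLE f e} d

/-! ### Almost separating overalgebras -/

/-- `(g ⋉ V, φ)` is an overalgebra of `g` almost separating of degree `p`, where `Ω ⊆ g*` is the set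
of generic points. The requirement that `Φ` be a section of the projection `(g ⋉ V)* → g*` is
built into `overMap`. -/
structure IsAlmostSeparating {g V : Type*} [LieRing g] [LieAlgebra ℝ g]
    [AddCommGroup V] [Module ℝ V] [FiniteDimensional ℝ V] [LieRingModule g V] [LieModule ℝ g V]
    (Ω : Set (Module.Dual ℝ g)) (φ : Module.Dual ℝ g → Module.Dual ℝ V) (p : ℕ) : Prop where
  degree : IsPolynomialOfDegree φ p
  image_orbit : ∀ ξ, overMap φ '' coadjointOrbit g ξ =
    coadjointOrbit (Semidirect g V) (overMap φ ξ)
  separating : ∀ ξ ∈ Ω,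
    {O | ∃ ξ', O = coadjointOrbit g ξ' ∧
      closedConvHull (overMap φ '' coadjointOrbit g ξ') =
        closedConvHull (overMap φ '' coadjointOrbit g ξ)}.Finite

/-! ### Symmetric powers of a Lie module -/

namespace SymAction

variable {M : Type*} [AddCommGroup M] [Module ℝ M]

/-- Auxiliary: the algebra morphism `a ↦ a + ε D a` into the dual numbers over `S(M)`. -/
def toDualNumbers (f : M →ₗ[ℝ] M) :
    SymmetricAlgebra ℝ M →ₐ[ℝ] TrivSqZeroExt (SymmetricAlgebra ℝ M) (SymmetricAlgebra ℝ M) :=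
  SymmetricAlgebra.lift
    ((TrivSqZeroExt.inlAlgHom ℝ (SymmetricAlgebra ℝ M) (SymmetricAlgebra ℝ M)).toLinearMap ∘ₗ
        SymmetricAlgebra.ι ℝ M +
      (TrivSqZeroExt.inrHom (SymmetricAlgebra ℝ M) (SymmetricAlgebra ℝ M)).restrictScalars ℝ ∘ₗ
        SymmetricAlgebra.ι ℝ M ∘ₗ f)

theorem toDualNumbers_ι (f : M →ₗ[ℝ] M) (m : M) :
    toDualNumbers f (SymmetricAlgebra.ι ℝ M m) =
      TrivSqZeroExt.inl (SymmetricAlgebra.ι ℝ M m) +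
        TrivSqZeroExt.inr (SymmetricAlgebra.ι ℝ M (f m)) := by
  simp [toDualNumbers]

theorem fst_toDualNumbers (f : M →ₗ[ℝ] M) (a : SymmetricAlgebra ℝ M) :
    (toDualNumbers f a).fst = a := by
  have h : (TrivSqZeroExt.fstHom ℝ (SymmetricAlgebra ℝ M) (SymmetricAlgebra ℝ M)).comp
      (toDualNumbers f) = AlgHom.id ℝ _ := by
    apply SymmetricAlgebra.algHom_ext
    ext m
    simp [toDualNumbers_ι]
  exact congrArg (fun F => F a) h

/-- The derivation of the symmetric algebra `S(M)` that extends the endomorphism `f` of `M`. -/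
def der (f : M →ₗ[ℝ] M) : Derivation ℝ (SymmetricAlgebra ℝ M) (SymmetricAlgebra ℝ M) :=
  Derivation.mk'
    ((TrivSqZeroExt.sndHom (SymmetricAlgebra ℝ M) (SymmetricAlgebra ℝ M)).restrictScalars ℝ ∘ₗ
      (toDualNumbers f).toLinearMap)
    (fun a b => by simp [fst_toDualNumbers, mul_comm])

theorem der_ι (f : M →ₗ[ℝ] M) (m : M) :
    der f (SymmetricAlgebra.ι ℝ M m) = SymmetricAlgebra.ι ℝ M (f m) := by
  simp [der, toDualNumbers_ι]

theorem der_ext {D D' : Derivation ℝ (SymmetricAlgebra ℝ M) (SymmetricAlgebra ℝ M)}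
    (h : ∀ m, D (SymmetricAlgebra.ι ℝ M m) = D' (SymmetricAlgebra.ι ℝ M m)) : D = D' := by
  ext a
  induction a using SymmetricAlgebra.induction with
  | algebraMap r => simp
  | ι x => exact h x
  | mul a b ha hb => simp [ha, hb]
  | add a b ha hb => simp [ha, hb]

variable {L : Type*} [LieRing L] [LieAlgebra ℝ L] [LieRingModule L M] [LieModule ℝ L M]

/-- The Lie algebra acts on `S(M)` by derivations: `x (m₁ ⋯ m_k) = ∑ m₁ ⋯ (x mᵢ) ⋯ m_k`. -/
instance : LieRingModule L (SymmetricAlgebra ℝ M) where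
  bracket x a := der (LieModule.toEnd ℝ L M x) a
  add_lie x y a := by
    change der _ a = (der _ + der _ : Derivation ℝ _ _) a
    congr 1
    apply der_ext
    intro m
    simp [der_ι]
  lie_add x a b := map_add _ a b
  leibniz_lie x y a := by
    change der _ (der _ a) = der _ a + der _ (der _ a)
    rw [← sub_eq_iff_eq_add, ← Derivation.commutator_apply]
    congr 1
    apply der_ext
    intro m
    simp [der_ι, Derivation.commutator_apply]

theorem lie_def (x : L) (a : SymmetricAlgebra ℝ M) :
    ⁅x, a⁆ = der (LieModule.toEnd ℝ L M x) a := rfl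

theorem lie_ι (x : L) (m : M) :
    ⁅x, SymmetricAlgebra.ι ℝ M m⁆ = SymmetricAlgebra.ι ℝ M ⁅x, m⁆ := der_ι _ m

theorem lie_mul (x : L) (a b : SymmetricAlgebra ℝ M) : ⁅x, a * b⁆ = ⁅x, a⁆ * b + a * ⁅x, b⁆ := by
  simp only [lie_def, Derivation.leibniz, smul_eq_mul]
  ring

instance : LieModule ℝ L (SymmetricAlgebra ℝ M) where
  smul_lie t x a := by
    change der _ a = (t • der _ : Derivation ℝ _ _) a
    congr 1
    apply der_ext
    intro m
    simp [der_ι]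
  lie_smul t x a := (der (LieModule.toEnd ℝ L M x)).map_smul t a

theorem lie_mem_pow (x : L) (k : ℕ) :
    ∀ a ∈ LinearMap.range (SymmetricAlgebra.ι ℝ M) ^ k,
      ⁅x, a⁆ ∈ LinearMap.range (SymmetricAlgebra.ι ℝ M) ^ k := by
  induction k with
  | zero =>
    intro a ha
    rw [pow_zero, Submodule.mem_one] at ha
    obtain ⟨r, rfl⟩ := ha
    rw [lie_def, Derivation.map_algebraMap]
    exact Submodule.zero_mem _
  | succ k ih =>
    intro a ha
    rw [pow_succ] at ha ⊢
    induction ha using Submodule.mul_induction_on' with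
    | mem_mul_mem b hb c hc =>
      obtain ⟨m, rfl⟩ := hc
      rw [lie_mul, lie_ι]
      exact Submodule.add_mem _ (Submodule.mul_mem_mul (ih b hb) ⟨m, rfl⟩)
        (Submodule.mul_mem_mul hb ⟨_, rfl⟩)
    | add b _ c _ hb hc =>
      rw [lie_add]
      exact Submodule.add_mem _ hb hc

end SymAction

/-- The symmetric power `S^k(M)` of an `L`-module `M`: the degree `k` part of the symmetric
algebra. -/
def SymPow (L M : Type*) [LieRing L] [LieAlgebra ℝ L] [AddCommGroup M] [Module ℝ M]
    [LieRingModule L M] [LieModule ℝ L M] (k : ℕ) : LieSubmodule ℝ L (SymmetricAlgebra ℝ M) :=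
  { (LinearMap.range (SymmetricAlgebra.ι ℝ M)) ^ k with
    lie_mem := fun {x a} ha => SymAction.lie_mem_pow x k a ha }

/-- `S_p(g) = g ⊕ S²(g) ⊕ ⋯ ⊕ S^p(g)`, with the adjoint action of `g`. The index `k : Fin p`
stands for the degree `k + 1`. -/
abbrev SymUpTo (g : Type*) [LieRing g] [LieAlgebra ℝ g] (p : ℕ) : Type _ :=
  ⨁ k : Fin p, SymPow g g (k + 1)

instance {g : Type*} [LieRing g] [LieAlgebra ℝ g] [FiniteDimensional ℝ g] (k : ℕ) :
    FiniteDimensional ℝ (SymPow g g k) := by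
  have h : ((LinearMap.range (SymmetricAlgebra.ι ℝ g)) ^ k).FG :=
    Submodule.FG.pow (Module.Finite.iff_fg.mp inferInstance) k
  exact Module.Finite.iff_fg.mpr h

instance {g : Type*} [LieRing g] [LieAlgebra ℝ g] [FiniteDimensional ℝ g] (p : ℕ) :
    FiniteDimensional ℝ (SymUpTo g p) :=
  Module.Finite.equiv
    (DirectSum.linearEquivFunOnFintype ℝ (Fin p) (fun k => SymPow g g (k + 1))).symm

/-- The element `x ⋯ x` (`k` factors) of `S^k(g)`. -/
def symPower {g : Type*} [LieRing g] [LieAlgebra ℝ g] (k : ℕ) (x : g) : SymPow g g k :=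
  ⟨SymmetricAlgebra.ι ℝ g x ^ k, Submodule.pow_mem_pow _ (LinearMap.mem_range_self _ x) k⟩

/-- `τ(x) = x + x ⬝ x + ⋯ + x ⋯ x`, as an element of `S_p(g)`. -/
def symTau {g : Type*} [LieRing g] [LieAlgebra ℝ g] (p : ℕ) (x : g) : SymUpTo g p :=
  ∑ k : Fin p, DirectSum.lof ℝ (Fin p) (fun k => SymPow g g (k + 1)) k (symPower (k + 1) x)

/-! ### Semisimple Lie algebras -/

/-- A real Lie algebra is split if it has a Cartan subalgebra `h` such that every `ad x`, `x ∈ h`,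
is triangularizable over `ℝ`. -/
def IsSplitLie (g : Type*) [LieRing g] [LieAlgebra ℝ g] : Prop :=
  ∃ H : LieSubalgebra ℝ g, ∃ _ : H.IsCartanSubalgebra, LieModule.IsTriangularizable ℝ H g

/-- The identification `g ≃ g*` of a semisimple Lie algebra with its dual by the Killing form. -/
def killingEquiv (g : Type*) [LieRing g] [LieAlgebra ℝ g] [FiniteDimensional ℝ g]
    [LieAlgebra.IsSemisimple ℝ g] : g ≃ₗ[ℝ] Module.Dual ℝ g :=
  LinearMap.BilinForm.toDual (killingForm ℝ g) (LieAlgebra.IsKilling.killingForm_nondegenerate ℝ g)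

/-- The generic points of the dual of a semisimple Lie algebra: those that correspond to regular
elements of `g`. -/
def genericSet (g : Type*) [LieRing g] [LieAlgebra ℝ g] [FiniteDimensional ℝ g]
    [LieAlgebra.IsSemisimple ℝ g] : Set (Module.Dual ℝ g) :=
  {ξ | LieAlgebra.IsRegular ℝ ((killingEquiv g).symm ξ)}

/-! ### The Lie algebra `sl(n, ℝ)` -/

/-- `sl(n, ℝ)`. -/
abbrev SL (n : ℕ) : Type := LieAlgebra.SpecialLinear.sl (Fin n) ℝ

/-- The trace form `⟨A, X⟩ = Tr(A X)` as a linear map from `sl(n, ℝ)` to its dual. -/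
def slTraceMap (n : ℕ) : SL n →ₗ[ℝ] Module.Dual ℝ (SL n) :=
  LinearMap.mk₂ ℝ (fun A X : SL n => Matrix.trace (A.1 * X.1))
    (fun A B X => by simp [add_mul]) (fun c A X => by simp)
    (fun A X Y => by simp [mul_add]) (fun c A X => by simp)

theorem slTraceMap_apply (n : ℕ) (A X : SL n) :
    slTraceMap n A X = Matrix.trace (A.1 * X.1) := rfl

theorem slTraceMap_injective (n : ℕ) : Function.Injective (slTraceMap n) := by
  rw [← LinearMap.ker_eq_bot, LinearMap.ker_eq_bot']
  intro A hA
  have h0 : Matrix.trace A.1 = 0 := A.2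
  have hT : A.1.transpose ∈ LieAlgebra.SpecialLinear.sl (Fin n) ℝ := by
    change Matrix.trace A.1.transpose = 0
    rw [Matrix.trace_transpose, h0]
  have h1 : Matrix.trace (A.1 * A.1.transpose) = 0 :=
    congrArg (fun f => f ⟨A.1.transpose, hT⟩) hA
  have h2 : A.1 = 0 := by
    have := Matrix.trace_mul_conjTranspose_self_eq_zero_iff (A := A.1)
    rw [Matrix.conjTranspose_eq_transpose_of_trivial] at this
    exact this.mp h1
  exact Subtype.ext h2

/-- The identification `sl(n, ℝ) ≃ sl(n, ℝ)*` by the trace form. -/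
def slTraceEquiv (n : ℕ) : SL n ≃ₗ[ℝ] Module.Dual ℝ (SL n) :=
  LinearEquiv.ofInjectiveOfFinrankEq (slTraceMap n) (slTraceMap_injective n)
    Subspace.dual_finrank_eq.symm

/-- The generic points of `sl(n, ℝ)*`: those that correspond to matrices with `n` distinct complex
eigenvalues. -/
def slGenericSet (n : ℕ) : Set (Module.Dual ℝ (SL n)) :=
  {ξ | (((slTraceEquiv n).symm ξ).1.charpoly.aroots ℂ).Nodup}

end

/-!
The orbit condition is so strong that it forces `φ` to be an invariant polynomial map with values in
the invariants of `V*`, and all such maps are obtained from the powers `x ^ k` by linear maps on the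
symmetric powers; the most separating one of them is universal.

Let `e : g ≃ g*` come from an invariant symmetric form, the Killing form or the trace form. The
orbit condition, applied to the exponentials of `(X, 0)` and of `(0, u)` in `g ⋉ V`, says that `φ`
is equivariant and that the coadjoint orbit of `ξ` contains the forms `ξ + (φ ξ)(⬝ u)`. The forms
`(φ ξ)(⬝ u)` are the annihilator of the stabilizer of `φ ξ`. Since the quadratic form is constant on
coadjoint orbits, the orthogonal of this stabilizer is totally isotropic
(`isotropic_of_image_orbit`). If `ξ` corresponds to an element of a split Cartan subalgebra `H`,
then `φ ξ` is annihilated by `H`; by the representation theory of `sl₂` an isotropic orthogonal then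
leaves no root vector outside of the stabilizer, so `φ ξ` is invariant
(`IsRootDecomposition.lie_eq_zero_of_isotropic`). The conjugates of `H` contain a neighbourhood of a
regular element of `H` (`eventually_exists_expEnd`), and `φ` is polynomial, so all values of `φ`
are invariant (`lie_eq_zero_of_image_orbit`).

Hence `φ ξ = c + ∑ F k (x ^ k)`, `ξ = e x`, with linear maps `F k` on `S^k(g)` that vanish on
`g S^k(g)` (`exists_sum_symPower_eq`). As `S^k(g)` is self-dual (`symPowDual`), its invariants have
the dimension of its coinvariants `S^k(g) ⧸ g S^k(g)`, and there is an intertwining endomorphism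
`b k` of `S^k(g)` with kernel `g S^k(g)` and invariant values (`exists_lieModuleHom_ker_eq_lieSpan`).
The map `ψ = ∑ b k (x ^ k)` satisfies the orbit condition because it is invariant with invariant
values (`image_orbit_of_invariant`), and every `F k` factors through `b k`, so `φ` is an affine
function of `ψ`. Therefore `ψ` has degree at least that of `φ`, and closed convex hulls of orbits
that agree for `ψ` also agree for `φ`: the finiteness condition passes from `φ` to `ψ`
(`IsAlmostSeparating.of_eq_add_comp`).
-/

noncomputable section

/-! ### The exponential of an endomorphism -/

section Exponential

variable {E E' : Type*} [AddCommGroup E] [Module ℝ E] [FiniteDimensional ℝ E]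
  [AddCommGroup E'] [Module ℝ E'] [FiniteDimensional ℝ E']

section Normed

variable {F : Type*} [NormedAddCommGroup F] [NormedSpace ℝ F] [FiniteDimensional ℝ F]

theorem hasSum_exp_toLinearMap (A : Module.End ℝ F) (ℓ : Module.End ℝ F →ₗ[ℝ] ℝ) :
    HasSum (fun n : ℕ => (n.factorial : ℝ)⁻¹ * ℓ (A ^ n))
      (ℓ (NormedSpace.exp (LinearMap.toContinuousLinearMap A) : F →L[ℝ] F).toLinearMap) := by
  have : CompleteSpace F := FiniteDimensional.complete ℝ F
  let c : (F →L[ℝ] F) →ₗ[ℝ] ℝ := ℓ ∘ₗ ContinuousLinearMap.coeLM ℝ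
  have hc : Continuous c := c.continuous_of_finiteDimensional
  refine ((NormedSpace.exp_series_hasSum_exp' (𝕂 := ℝ)
    (LinearMap.toContinuousLinearMap A)).map c hc).congr_fun ?_
  intro n
  have hpow : ((LinearMap.toContinuousLinearMap A ^ n : F →L[ℝ] F) : Module.End ℝ F) = A ^ n := by
    ext v
    simp
  simp [c, hpow]

/-- For a normed space the exponential defined by the module topology is the one of the Banach
algebra of continuous endomorphisms. -/
theorem expEnd_eq_exp (A : Module.End ℝ F) :
    expEnd A = (NormedSpace.exp (LinearMap.toContinuousLinearMap A) : F →L[ℝ] F).toLinearMap := by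
  let _ : TopologicalSpace (Module.End ℝ F) := moduleTopology ℝ (Module.End ℝ F)
  have : IsModuleTopology ℝ (Module.End ℝ F) := ⟨rfl⟩
  have : IsTopologicalAddGroup (Module.End ℝ F) := IsModuleTopology.topologicalAddGroup ℝ _
  let c : (F →L[ℝ] F) →ₗ[ℝ] Module.End ℝ F := ContinuousLinearMap.coeLM ℝ
  have hc : Continuous c := c.continuous_of_finiteDimensional
  have hc' : Continuous (LinearMap.toContinuousLinearMap : Module.End ℝ F ≃ₗ[ℝ] (F →L[ℝ] F)) :=
    IsModuleTopology.continuous_of_linearMap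
      (LinearMap.toContinuousLinearMap : Module.End ℝ F ≃ₗ[ℝ] (F →L[ℝ] F)).toLinearMap
  have : T2Space (Module.End ℝ F) :=
    T2Space.of_injective_continuous (LinearEquiv.injective _) hc'
  have : CompleteSpace F := FiniteDimensional.complete ℝ F
  have h := (NormedSpace.exp_series_hasSum_exp' (𝕂 := ℝ)
    (LinearMap.toContinuousLinearMap A)).map c hc
  refine Eq.trans ?_ h.tsum_eq
  unfold expEnd
  congr 1
  ext n v
  simp [c]

theorem expEnd_neg_mul_aux (A : Module.End ℝ F) : expEnd (-A) * expEnd A = 1 := by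
  have : CompleteSpace F := FiniteDimensional.complete ℝ F
  let _ : NormedAlgebra ℚ (F →L[ℝ] F) := NormedAlgebra.restrictScalars ℚ ℝ _
  have h := NormedSpace.exp_add_of_commute
    (Commute.neg_left (Commute.refl (LinearMap.toContinuousLinearMap A)))
  rw [neg_add_cancel, NormedSpace.exp_zero] at h
  rw [expEnd_eq_exp, expEnd_eq_exp, map_neg]
  ext v
  exact (congrArg (fun T : F →L[ℝ] F => T v) h).symm

theorem hasDerivAt_expEnd_aux (A : Module.End ℝ F) (v : F) (ℓ : F →ₗ[ℝ] ℝ) (t : ℝ) :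
    HasDerivAt (fun s : ℝ => ℓ (expEnd (s • A) v)) (ℓ (A (expEnd (t • A) v))) t := by
  have : CompleteSpace F := FiniteDimensional.complete ℝ F
  have h := hasDerivAt_exp_smul_const' (𝕂 := ℝ) (LinearMap.toContinuousLinearMap A) t
  let c : (F →L[ℝ] F) →ₗ[ℝ] ℝ :=
    ℓ ∘ₗ (LinearMap.applyₗ v) ∘ₗ ContinuousLinearMap.coeLM ℝ
  have h2 := (LinearMap.toContinuousLinearMap c).hasFDerivAt.comp_hasDerivAt t h
  simp only [expEnd_eq_exp, map_smul]
  exact h2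

end Normed

/-- Every finite-dimensional real vector space carries a norm; this transfers facts about the
exponential from normed spaces. -/
theorem hasSum_expEnd (A : Module.End ℝ E) (ℓ : Module.End ℝ E →ₗ[ℝ] ℝ) :
    HasSum (fun n : ℕ => (n.factorial : ℝ)⁻¹ * ℓ (A ^ n)) (ℓ (expEnd A)) := by
  let f := (Module.finBasis ℝ E).equivFun
  let _ : NormedAddCommGroup E := NormedAddCommGroup.induced E _ f f.injective
  let _ : NormedSpace ℝ E := NormedSpace.induced ℝ E _ f
  have h := hasSum_exp_toLinearMap A ℓ
  rwa [← expEnd_eq_exp] at h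

theorem expEnd_neg_mul (A : Module.End ℝ E) : expEnd (-A) * expEnd A = 1 := by
  let f := (Module.finBasis ℝ E).equivFun
  let _ : NormedAddCommGroup E := NormedAddCommGroup.induced E _ f f.injective
  let _ : NormedSpace ℝ E := NormedSpace.induced ℝ E _ f
  exact expEnd_neg_mul_aux A

theorem hasDerivAt_expEnd (A : Module.End ℝ E) (v : E) (ℓ : E →ₗ[ℝ] ℝ) (t : ℝ) :
    HasDerivAt (fun s : ℝ => ℓ (expEnd (s • A) v)) (ℓ (A (expEnd (t • A) v))) t := by
  let f := (Module.finBasis ℝ E).equivFun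
  let _ : NormedAddCommGroup E := NormedAddCommGroup.induced E _ f f.injective
  let _ : NormedSpace ℝ E := NormedSpace.induced ℝ E _ f
  exact hasDerivAt_expEnd_aux A v ℓ t

theorem hasSum_expEnd_apply (A : Module.End ℝ E) (v : E) (ℓ : E →ₗ[ℝ] ℝ) :
    HasSum (fun n : ℕ => (n.factorial : ℝ)⁻¹ * ℓ ((A ^ n) v)) (ℓ (expEnd A v)) :=
  hasSum_expEnd A (ℓ ∘ₗ LinearMap.applyₗ v)

theorem expEnd_mul_neg (A : Module.End ℝ E) : expEnd A * expEnd (-A) = 1 := by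
  simpa using expEnd_neg_mul (-A)

/-- The exponential of an endomorphism as a unit. -/
def expUnit (A : Module.End ℝ E) : (Module.End ℝ E)ˣ :=
  ⟨expEnd A, expEnd (-A), expEnd_mul_neg A, expEnd_neg_mul A⟩

theorem eq_of_forall_dual {v w : E} (h : ∀ ℓ : E →ₗ[ℝ] ℝ, ℓ v = ℓ w) : v = w :=
  (Module.forall_dual_apply_eq_zero_iff ℝ (v - w)).mp (fun ℓ => by simp [h ℓ]) |> sub_eq_zero.mp

theorem map_expEnd (T : E →ₗ[ℝ] E') {A : Module.End ℝ E} {A' : Module.End ℝ E'}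
    (h : ∀ v, T (A v) = A' (T v)) (v : E) : T (expEnd A v) = expEnd A' (T v) := by
  have hn : ∀ n : ℕ, ∀ v, T ((A ^ n) v) = (A' ^ n) (T v) := by
    intro n
    induction n with
    | zero => simp
    | succ n ih => intro v; simp [pow_succ, ih, h]
  refine eq_of_forall_dual fun ℓ => ?_
  have h1 := hasSum_expEnd_apply A v (ℓ ∘ₗ T)
  have h2 := hasSum_expEnd_apply A' (T v) ℓ
  simp only [LinearMap.comp_apply, hn] at h1
  exact h1.unique h2

theorem expEnd_apply_of_eq_zero {A : Module.End ℝ E} {v : E} (h : A v = 0) : expEnd A v = v := by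
  refine eq_of_forall_dual fun ℓ => ?_
  refine (hasSum_expEnd_apply A v ℓ).unique ?_
  convert hasSum_single (f := fun n : ℕ => (n.factorial : ℝ)⁻¹ * ℓ ((A ^ n) v)) 0 ?_ using 1
  · simp
  · intro n hn
    obtain ⟨m, rfl⟩ := Nat.exists_eq_succ_of_ne_zero hn
    simp [pow_succ, h]

theorem expEnd_apply_of_sq_eq_zero {A : Module.End ℝ E} {v : E} (h : A (A v) = 0) :
    expEnd A v = v + A v := by
  refine eq_of_forall_dual fun ℓ => ?_
  refine (hasSum_expEnd_apply A v ℓ).unique ?_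
  convert hasSum_sum_of_ne_finset_zero (s := Finset.range 2)
    (f := fun n : ℕ => (n.factorial : ℝ)⁻¹ * ℓ ((A ^ n) v)) ?_ using 1
  · simp [Finset.sum_range_succ]
  · intro n hn
    obtain ⟨m, rfl⟩ := Nat.exists_eq_add_of_le' (not_lt.mp (mt Finset.mem_range.mpr hn))
    simp [pow_add, pow_two, h]
  · infer_instance

theorem eq_zero_of_forall_expEnd_smul_eq {A : Module.End ℝ E} {v : E}
    (h : ∀ t : ℝ, expEnd (t • A) v = v) : A v = 0 := by
  refine eq_of_forall_dual fun ℓ => ?_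
  have h1 := hasDerivAt_expEnd A v ℓ 0
  simp only [h] at h1
  simpa using h1.unique (hasDerivAt_const (0 : ℝ) (ℓ v))

/-- The exponential of an operator that is skew for a bilinear form preserves the form. -/
theorem bilin_expEnd_expEnd {B : E →ₗ[ℝ] E →ₗ[ℝ] ℝ} {A : Module.End ℝ E}
    (h : ∀ v w, B (A v) w = - B v (A w)) (v w : E) :
    B (expEnd A v) (expEnd A w) = B v w := by
  have hn : ∀ n : ℕ, ∀ v w, B ((A ^ n) v) w = B v (((-A) ^ n) w) := by
    intro n
    induction n with
    | zero => simp
    | succ n ih =>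
      intro v w
      rw [pow_succ, Module.End.mul_apply, ih, pow_succ', Module.End.mul_apply, LinearMap.neg_apply,
        map_neg, ← h]
  have h2 : ∀ v w, B (expEnd A v) w = B v (expEnd (-A) w) := by
    intro v w
    have h1 := hasSum_expEnd_apply A v (B.flip w)
    have h2 := hasSum_expEnd_apply (-A) w (B v)
    simp only [LinearMap.flip_apply, hn] at h1
    exact h1.unique h2
  rw [h2]
  exact congrArg (fun T : Module.End ℝ E => B v (T w)) (expEnd_neg_mul A)

/-- If `x₀` lies in a subspace `H` which together with the tangent space `L x₀` spans the
representation `E`, then the translates of `H` by the exponentials of `L` cover a neighbourhood of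
`x₀`: the map `(X, Z) ↦ exp(X) Z` is a submersion at `(0, x₀)`. -/
theorem eventually_exists_expEnd {F G : Type*} [NormedAddCommGroup F] [NormedSpace ℝ F]
    [FiniteDimensional ℝ F] [NormedAddCommGroup G] [NormedSpace ℝ G] [FiniteDimensional ℝ G]
    (a : G →ₗ[ℝ] Module.End ℝ F) (H : Submodule ℝ F) (x₀ : F) (hx₀ : x₀ ∈ H)
    (h : ∀ y, ∃ X, ∃ z ∈ H, y = a X x₀ + z) :
    ∀ᶠ x in nhds x₀, ∃ X, ∃ z ∈ H, x = expEnd (a X) z := by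
  have : CompleteSpace F := FiniteDimensional.complete ℝ F
  have : CompleteSpace G := FiniteDimensional.complete ℝ G
  have : CompleteSpace H := FiniteDimensional.complete ℝ H
  let a' : G →L[ℝ] (F →L[ℝ] F) :=
    LinearMap.toContinuousLinearMap
      ((LinearMap.toContinuousLinearMap : Module.End ℝ F ≃ₗ[ℝ] (F →L[ℝ] F)).toLinearMap ∘ₗ a)
  let f : G × H → F := fun q => (NormedSpace.exp (a' q.1)) (q.2 : F)
  have hexp : HasStrictFDerivAt (NormedSpace.exp : (F →L[ℝ] F) → (F →L[ℝ] F))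
      (1 : (F →L[ℝ] F) →L[ℝ] (F →L[ℝ] F)) (a' ((0 : G), (⟨x₀, hx₀⟩ : H)).1) := by
    simpa using hasStrictFDerivAt_exp_zero (𝕂 := ℝ) (𝔸 := F →L[ℝ] F)
  have h1 := hexp.comp ((0 : G), (⟨x₀, hx₀⟩ : H))
    (a'.comp (ContinuousLinearMap.fst ℝ G H)).hasStrictFDerivAt
  have h2 := h1.clm_apply
    (H.subtypeL.comp (ContinuousLinearMap.snd ℝ G H)).hasStrictFDerivAt
  have h3 := h2.map_nhds_eq_of_surj (by
    rw [LinearMap.range_eq_top]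
    intro y
    obtain ⟨X, z, hz, rfl⟩ := h y
    refine ⟨(X, ⟨z, hz⟩), ?_⟩
    simp [a', add_comm])
  have h4 : f (0, ⟨x₀, hx₀⟩) = x₀ := by simp [f]
  have h5 : Filter.map f (nhds (0, ⟨x₀, hx₀⟩)) = nhds (f (0, ⟨x₀, hx₀⟩)) := h3
  rw [h4] at h5
  rw [← h5, Filter.eventually_map]
  refine Filter.Eventually.of_forall fun q => ⟨q.1, q.2, q.2.2, ?_⟩
  rw [expEnd_eq_exp]
  rfl

/-- The local covering of `eventually_exists_expEnd` on a line through `x₀`, without reference to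
norms. -/
theorem eventually_exists_expEnd_line (a : E' →ₗ[ℝ] Module.End ℝ E) (H : Submodule ℝ E) (x₀ : E)
    (hx₀ : x₀ ∈ H) (h : ∀ y, ∃ X, ∃ z ∈ H, y = a X x₀ + z) (y : E) :
    ∀ᶠ t : ℝ in nhds 0, ∃ X, ∃ z ∈ H, x₀ + t • y = expEnd (a X) z := by
  let f := (Module.finBasis ℝ E).equivFun
  let _ : NormedAddCommGroup E := NormedAddCommGroup.induced E _ f f.injective
  let _ : NormedSpace ℝ E := NormedSpace.induced ℝ E _ f
  let f' := (Module.finBasis ℝ E').equivFun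
  let _ : NormedAddCommGroup E' := NormedAddCommGroup.induced E' _ f' f'.injective
  let _ : NormedSpace ℝ E' := NormedSpace.induced ℝ E' _ f'
  have h1 := eventually_exists_expEnd a H x₀ hx₀ h
  have h2 : Filter.Tendsto (fun t : ℝ => x₀ + t • y) (nhds 0) (nhds x₀) := by
    have : Continuous (fun t : ℝ => x₀ + t • y) := by fun_prop
    simpa using this.tendsto 0
  exact h2.eventually h1

end Exponential

/-! ### Symmetric powers and homogeneous polynomial maps -/

section Polarization

variable {M A : Type*} [AddCommGroup M] [Module ℝ M] [CommRing A] [Algebra ℝ A]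

/-- One step of polarization: the coefficient of `t` in `(x + t y) ^ (n + 1) z`. -/
theorem map_pow_mul_eq_zero_of_pow_succ (i : M →ₗ[ℝ] A) (μ : A →ₗ[ℝ] ℝ) (n : ℕ) (z : A)
    (h : ∀ x, μ (i x ^ (n + 1) * z) = 0) (x y : M) : μ (i x ^ n * (i y * z)) = 0 := by
  let P : Polynomial ℝ := ∑ m ∈ Finset.range (n + 1 + 1),
    Polynomial.C (((n + 1).choose m : ℝ) * μ (i y ^ m * i x ^ (n + 1 - m) * z)) * Polynomial.X ^ m
  have hP : P = 0 := by
    refine Polynomial.funext fun t => ?_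
    have h1 := h (t • y + x)
    rw [map_add, map_smul, add_pow, Finset.sum_mul, map_sum] at h1
    rw [Polynomial.eval_zero, ← h1, Polynomial.eval_finsetSum]
    refine Finset.sum_congr rfl fun m _ => ?_
    have : (t • i y) ^ m * i x ^ (n + 1 - m) * ((n + 1).choose m : A) * z =
        (((n + 1).choose m : ℝ) * t ^ m) • (i y ^ m * i x ^ (n + 1 - m) * z) := by
      simp only [Algebra.smul_def, map_mul, map_natCast, map_pow, mul_pow]
      ring
    rw [this, map_smul, smul_eq_mul]
    simp
    ring
  have h1 : P.coeff 1 = 0 := by rw [hP, Polynomial.coeff_zero]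
  have h2 : P.coeff 1 = ((n : ℝ) + 1) * μ (i x ^ n * (i y * z)) := by
    simp only [P, Polynomial.finsetSum_coeff, Polynomial.coeff_C_mul_X_pow]
    rw [Finset.sum_ite_eq, if_pos (by simp)]
    rw [Nat.choose_one_right, pow_one, Nat.add_sub_cancel]
    push_cast
    congr 2
    ring
  rw [h1] at h2
  exact (mul_eq_zero.mp h2.symm).resolve_left (by positivity)

/-- Polarization: a functional that vanishes on all `k`-th powers of elements of a subspace vanishes
on all products of `k` of its elements. -/
theorem map_mul_eq_zero_of_forall_pow (i : M →ₗ[ℝ] A) (μ : A →ₗ[ℝ] ℝ) (k : ℕ) :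
    ∀ z : A, (∀ x, μ (i x ^ k * z) = 0) → ∀ w ∈ LinearMap.range i ^ k, μ (w * z) = 0 := by
  induction k with
  | zero =>
    intro z h w hw
    rw [pow_zero, Submodule.mem_one] at hw
    obtain ⟨r, rfl⟩ := hw
    have := h 0
    rw [pow_zero, one_mul] at this
    rw [← Algebra.smul_def, map_smul, this, smul_zero]
  | succ k ih =>
    intro z h w hw
    rw [pow_succ] at hw
    induction hw using Submodule.mul_induction_on' with
    | mem_mul_mem b hb c hc =>
      obtain ⟨y, rfl⟩ := hc
      rw [mul_assoc]
      exact ih _ (fun x => map_pow_mul_eq_zero_of_pow_succ i μ k z h x y) b hb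
    | add b _ c _ hb hc => rw [add_mul, map_add, hb, hc, add_zero]

theorem prod_mem_range_pow (i : M →ₗ[ℝ] A) {k : ℕ} (x : Fin k → M) :
    ∏ j, i (x j) ∈ LinearMap.range i ^ k := by
  induction k with
  | zero => simpa [Submodule.mem_one] using ⟨1, map_one _⟩
  | succ k ih =>
    rw [Fin.prod_univ_succ, pow_succ']
    exact Submodule.mul_mem_mul ⟨_, rfl⟩ (ih _)

end Polarization

section SymmetricPower

variable {g : Type*} [LieRing g] [LieAlgebra ℝ g]

@[simp] theorem coe_symPower (k : ℕ) (x : g) :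
    (symPower k x : SymmetricAlgebra ℝ g) = SymmetricAlgebra.ι ℝ g x ^ k := rfl

/-- The inclusion of the symmetric power `S^k(g)` into the symmetric algebra. -/
def symPowIncl (k : ℕ) : SymPow g g k →ₗ[ℝ] SymmetricAlgebra ℝ g :=
  (SymPow g g k).toSubmodule.subtype

@[simp] theorem symPowIncl_apply (k : ℕ) (s : SymPow g g k) :
    symPowIncl k s = (s : SymmetricAlgebra ℝ g) := rfl

theorem span_range_symPower (k : ℕ) :
    Submodule.span ℝ (Set.range (symPower k : g → SymPow g g k)) = ⊤ := by
  by_contra hne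
  obtain ⟨f, hf0, hf⟩ := Submodule.exists_le_ker_of_lt_top _ (lt_top_iff_ne_top.mpr hne)
  obtain ⟨μ, hμ⟩ := LinearMap.exists_extend (p := (SymPow g g k).toSubmodule) f
  apply hf0
  ext w
  have h1 : ∀ x, μ (SymmetricAlgebra.ι ℝ g x ^ k * 1) = 0 := by
    intro x
    have h2 : f (symPower k x) = 0 := hf (Submodule.subset_span ⟨x, rfl⟩)
    rw [← hμ] at h2
    rw [mul_one]
    exact h2
  have h3 := map_mul_eq_zero_of_forall_pow (SymmetricAlgebra.ι ℝ g) μ k 1 h1 w.1 w.2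
  rw [mul_one] at h3
  rw [← hμ]
  exact h3

theorem lie_symPower (X x : g) (k : ℕ) :
    ((⁅X, symPower k x⁆ : SymPow g g k) : SymmetricAlgebra ℝ g) =
      k • (SymmetricAlgebra.ι ℝ g x ^ (k - 1) * SymmetricAlgebra.ι ℝ g ⁅X, x⁆) := by
  rw [LieSubmodule.coe_bracket, coe_symPower, SymAction.lie_def, Derivation.leibniz_pow,
    SymAction.der_ι, LieModule.toEnd_apply_apply, smul_eq_mul]

theorem linearMap_ext_symPower {k : ℕ} {W : Type*} [AddCommGroup W] [Module ℝ W]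
    {F G : SymPow g g k →ₗ[ℝ] W} (h : ∀ x, F (symPower k x) = G (symPower k x)) : F = G :=
  LinearMap.ext_on_range (span_range_symPower k) h

variable [FiniteDimensional ℝ g]

/-- A symmetric tensor is determined by the polynomial function that it defines on the dual. -/
theorem eq_zero_of_forall_lift_eq_zero (s : SymmetricAlgebra ℝ g)
    (h : ∀ ℓ : g →ₗ[ℝ] ℝ, SymmetricAlgebra.lift ℓ s = 0) : s = 0 := by
  let b := Module.finBasis ℝ g
  apply (SymmetricAlgebra.equivMvPolynomial b).injective
  rw [map_zero]
  refine MvPolynomial.funext fun c => ?_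
  have h1 : (MvPolynomial.aeval c).comp
      (SymmetricAlgebra.equivMvPolynomial b : SymmetricAlgebra ℝ g →ₐ[ℝ] _) =
      SymmetricAlgebra.lift (b.constr ℝ c) := by
    apply SymmetricAlgebra.algHom_ext
    refine b.ext fun i => ?_
    simp
  have h2 := congrArg (fun F : SymmetricAlgebra ℝ g →ₐ[ℝ] ℝ => F s) h1
  simp only [h] at h2
  rw [map_zero]
  exact h2

/-- A symmetric isomorphism `e : g ≃ g*` induces an isomorphism `Θ` of `S^k(g)` with its dual for
which `Θ(y ^ k)(x ^ k) = (e x y) ^ k`. Both spaces are quotients of the space of formal linear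
combinations of elements of `g`, by the same subspace. -/
theorem exists_symPow_equiv_dual (e : g ≃ₗ[ℝ] Module.Dual ℝ g) (he : ∀ x y, e x y = e y x) (k : ℕ) :
    ∃ Θ : SymPow g g k ≃ₗ[ℝ] Module.Dual ℝ (SymPow g g k),
      ∀ s x, Θ s (symPower k x) = SymmetricAlgebra.lift (e x) (s : SymmetricAlgebra ℝ g) := by
  let v : g → Module.Dual ℝ (SymPow g g k) := fun y =>
    (SymmetricAlgebra.lift (e y)).toLinearMap ∘ₗ symPowIncl k
  let G := Finsupp.linearCombination ℝ (symPower k : g → SymPow g g k)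
  let E := Finsupp.linearCombination ℝ v
  have hG : Function.Surjective G := by
    rw [← LinearMap.range_eq_top, Finsupp.range_linearCombination, span_range_symPower]
  have hE : Function.Surjective E := by
    rw [← LinearMap.range_eq_top, Finsupp.range_linearCombination,
      ← Subspace.dualCoannihilator_dualAnnihilator_eq (W := Submodule.span ℝ (Set.range v))]
    have : (Submodule.span ℝ (Set.range v)).dualCoannihilator = ⊥ := by
      rw [eq_bot_iff]
      intro s hs
      rw [Submodule.mem_dualCoannihilator] at hs
      refine Subtype.ext (eq_zero_of_forall_lift_eq_zero _ fun ℓ => ?_)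
      have := hs (v (e.symm ℓ)) (Submodule.subset_span ⟨_, rfl⟩)
      simpa [v] using this
    rw [this, Submodule.dualAnnihilator_bot]
  have hEG : ∀ c x, E c (symPower k x) =
      SymmetricAlgebra.lift (e x) (G c : SymmetricAlgebra ℝ g) := by
    intro c x
    induction c using Finsupp.induction_linear with
    | zero => simp
    | add f h hf hh => simp [hf, hh]
    | single y a => simp [E, G, v, he x y]
  have hker : LinearMap.ker G = LinearMap.ker E := by
    ext c
    rw [LinearMap.mem_ker, LinearMap.mem_ker]
    constructor
    · intro h
      refine linearMap_ext_symPower fun x => ?_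
      rw [hEG, h]
      simp
    · intro h
      refine Subtype.ext (eq_zero_of_forall_lift_eq_zero _ fun ℓ => ?_)
      have := hEG c (e.symm ℓ)
      rw [h, LinearEquiv.apply_symm_apply] at this
      exact this.symm
  refine ⟨(G.quotKerEquivOfSurjective hG).symm ≪≫ₗ Submodule.quotEquivOfEq _ _ hker ≪≫ₗ
    E.quotKerEquivOfSurjective hE, fun s x => ?_⟩
  obtain ⟨c, rfl⟩ := hG s
  rw [← hEG]
  congr 1
  simp only [LinearEquiv.trans_apply]
  have : (G.quotKerEquivOfSurjective hG).symm (G c) = Submodule.Quotient.mk c := by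
    rw [LinearEquiv.symm_apply_eq]
    rfl
  rw [this]
  rfl

/-- The isomorphism of `S^k(g)` with its dual induced by a symmetric isomorphism `e : g ≃ g*`; it
sends `y ^ k` to the form with the value `(e x y) ^ k` at `x ^ k`. -/
def symPowDual (e : g ≃ₗ[ℝ] Module.Dual ℝ g) (he : ∀ x y, e x y = e y x) (k : ℕ) :
    SymPow g g k ≃ₗ[ℝ] Module.Dual ℝ (SymPow g g k) :=
  (exists_symPow_equiv_dual e he k).choose

variable (e : g ≃ₗ[ℝ] Module.Dual ℝ g) (he : ∀ x y, e x y = e y x)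

theorem symPowDual_apply_symPower (k : ℕ) (s : SymPow g g k) (x : g) :
    symPowDual e he k s (symPower k x) =
      SymmetricAlgebra.lift (e x) (s : SymmetricAlgebra ℝ g) :=
  (exists_symPow_equiv_dual e he k).choose_spec s x

theorem symPowDual_symPower (k : ℕ) (y : g) (s : SymPow g g k) :
    symPowDual e he k (symPower k y) s =
      SymmetricAlgebra.lift (e y) (s : SymmetricAlgebra ℝ g) := by
  have : symPowDual e he k (symPower k y) =
      (SymmetricAlgebra.lift (e y)).toLinearMap ∘ₗ symPowIncl k := by
    refine linearMap_ext_symPower fun x => ?_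
    rw [symPowDual_apply_symPower]
    simp [he x y]
  rw [this]
  rfl

theorem symPowDual_lie (hinv : ∀ X x y : g, e ⁅X, x⁆ y = - e x ⁅X, y⁆) (k : ℕ) (X : g)
    (s w : SymPow g g k) : symPowDual e he k ⁅X, s⁆ w = - symPowDual e he k s ⁅X, w⁆ := by
  let T := (LieModule.toEnd ℝ g (SymPow g g k) X)
  have h1 : (symPowDual e he k).toLinearMap ∘ₗ T =
      - (LinearMap.lcomp ℝ ℝ T ∘ₗ (symPowDual e he k).toLinearMap) := by
    refine linearMap_ext_symPower fun y => linearMap_ext_symPower fun x => ?_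
    simp only [LinearMap.comp_apply, LinearEquiv.coe_coe, LinearMap.neg_apply,
      LinearMap.lcomp_apply, T, LieModule.toEnd_apply_apply, symPowDual_symPower,
      symPowDual_apply_symPower, lie_symPower]
    simp only [map_nsmul, map_mul, map_pow, SymmetricAlgebra.lift_ι_apply, he x y]
    rw [he x ⁅X, y⁆, hinv]
    simp
  exact congrArg (fun F => F s w) h1

include e he in
/-- Every homogeneous polynomial map of degree `k` is `x ↦ F(x ^ k)` for a linear map `F` on the
symmetric power `S^k(g)`. -/
theorem exists_linearMap_symPower_eq (k : ℕ) {W : Type*} [AddCommGroup W] [Module ℝ W]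
    (m : MultilinearMap ℝ (fun _ : Fin k => g) W) :
    ∃ F : SymPow g g k →ₗ[ℝ] W, ∀ x, F (symPower k x) = m (fun _ => x) := by
  let b := Module.finBasis ℝ g
  let T : (Fin k → Fin (Module.finrank ℝ g)) → SymPow g g k := fun f =>
    ⟨∏ j, SymmetricAlgebra.ι ℝ g (e.symm (b.coord (f j))), prod_mem_range_pow _ _⟩
  refine ⟨∑ f, (symPowDual e he k (T f)).smulRight (m fun j => b (f j)), fun x => ?_⟩
  have h1 : m (fun _ => x) = m (fun _ => ∑ i, b.repr x i • b i) := by rw [b.sum_repr]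
  rw [h1, MultilinearMap.map_sum, LinearMap.sum_apply]
  refine Finset.sum_congr rfl fun f _ => ?_
  rw [MultilinearMap.map_smul_univ, LinearMap.smulRight_apply, symPowDual_apply_symPower]
  congr 1
  simp [T, he x]

include e he in
/-- The curve `(exp(t X) x) ^ k` in `S^k(g)` has derivative `X ((exp(t X) x) ^ k)`. -/
theorem hasDerivAt_symPower_expEnd (k : ℕ) (μ : SymPow g g k →ₗ[ℝ] ℝ) (X x : g) (t : ℝ) :
    HasDerivAt (fun s : ℝ => μ (symPower k (expEnd (s • LieModule.toEnd ℝ g g X) x)))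
      (μ ⁅X, symPower k (expEnd (t • LieModule.toEnd ℝ g g X) x)⁆) t := by
  obtain ⟨s, rfl⟩ := (symPowDual e he k).surjective μ
  have hs : s ∈ Submodule.span ℝ (Set.range (symPower k : g → SymPow g g k)) := by
    rw [span_range_symPower]
    trivial
  induction hs using Submodule.span_induction with
  | mem s hs =>
    obtain ⟨y, rfl⟩ := hs
    simp only [symPowDual_symPower, lie_symPower]
    have h := (hasDerivAt_expEnd (LieModule.toEnd ℝ g g X) x (e y) t).pow k
    refine (h.congr_deriv ?_).congr_of_eventuallyEq (Filter.Eventually.of_forall fun r => ?_)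
    · simp [mul_assoc]
    · simp
  | zero => simpa using hasDerivAt_const t (0 : ℝ)
  | add s s' _ _ h h' =>
    simp only [map_add, LinearMap.add_apply]
    exact h.add h'
  | smul a s _ h =>
    simp only [map_smul, LinearMap.smul_apply]
    exact h.const_mul a

end SymmetricPower

/-! ### Invariants and coinvariants of a self-dual module -/

section Coinvariants

variable {L M : Type*} [LieRing L] [LieAlgebra ℝ L] [AddCommGroup M] [Module ℝ M]
  [FiniteDimensional ℝ M] [LieRingModule L M] [LieModule ℝ L M]

/-- The subspace `L M` of a Lie module, spanned by the elements `⁅X, s⁆`. -/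
def lieSpan (L M : Type*) [LieRing L] [AddCommGroup M] [Module ℝ M] [LieRingModule L M] :
    Submodule ℝ M :=
  Submodule.span ℝ {m | ∃ (X : L) (s : M), ⁅X, s⁆ = m}

/-- In a self-dual module the invariants and the coinvariants `M ⧸ L M` have the same dimension.
Hence there is an intertwining map `M → M ⧸ L M ≃ M ^ L ⊆ M` whose kernel is exactly `L M`; complete
reducibility is not needed. -/
theorem exists_lieModuleHom_ker_eq_lieSpan (Θ : M ≃ₗ[ℝ] Module.Dual ℝ M)
    (h : ∀ (X : L) s w, Θ ⁅X, s⁆ w = - Θ s ⁅X, w⁆) :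
    ∃ b : M →ₗ⁅ℝ,L⁆ M, (∀ (X : L) s, ⁅X, b s⁆ = 0) ∧
      LinearMap.ker (b : M →ₗ[ℝ] M) = lieSpan L M := by
  let I : Submodule ℝ M := (LieModule.maxTrivSubmodule ℝ L M).toSubmodule
  have hI : ∀ m, m ∈ I ↔ ∀ X : L, ⁅X, m⁆ = 0 := fun m => LieModule.mem_maxTrivSubmodule ℝ L M m
  have h1 : I.map Θ.toLinearMap = (lieSpan L M).dualAnnihilator := by
    ext f
    rw [Submodule.mem_dualAnnihilator, Submodule.mem_map]
    constructor
    · rintro ⟨m, hm, rfl⟩ w hw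
      induction hw using Submodule.span_induction with
      | mem w hw =>
        obtain ⟨X, s, rfl⟩ := hw
        rw [LinearEquiv.coe_coe, ← neg_eq_zero, ← h, (hI m).mp hm X]
        simp
      | zero => simp
      | add w w' _ _ hw hw' => rw [map_add, hw, hw', add_zero]
      | smul a w _ hw => rw [map_smul, hw, smul_zero]
    · intro hf
      refine ⟨Θ.symm f, (hI _).mpr fun X => ?_, by simp⟩
      apply Θ.injective
      rw [map_zero]
      ext w
      rw [h, LinearEquiv.apply_symm_apply, hf _ (Submodule.subset_span ⟨X, w, rfl⟩)]
      simp
  have h2 : Module.finrank ℝ (M ⧸ lieSpan L M) = Module.finrank ℝ I := by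
    have h3 := Subspace.finrank_add_finrank_dualAnnihilator_eq (lieSpan L M)
    have h4 := Submodule.finrank_quotient_add_finrank (lieSpan L M)
    have h5 : Module.finrank ℝ (I.map Θ.toLinearMap) = Module.finrank ℝ I :=
      LinearEquiv.finrank_map_eq Θ I
    rw [h1] at h5
    omega
  let c := LinearEquiv.ofFinrankEq _ _ h2
  let B : M →ₗ[ℝ] M := I.subtype ∘ₗ c.toLinearMap ∘ₗ (lieSpan L M).mkQ
  have hB : ∀ (X : L) s, ⁅X, B s⁆ = 0 := fun X s => (hI _).mp (c _).2 X
  have hker : LinearMap.ker B = lieSpan L M := by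
    rw [LinearMap.ker_comp_of_ker_eq_bot _ I.ker_subtype, LinearMap.ker_comp_of_ker_eq_bot _ c.ker,
      Submodule.ker_mkQ]
  refine ⟨{ B with map_lie' := fun {X s} => ?_ }, hB, hker⟩
  change B ⁅X, s⁆ = ⁅X, B s⁆
  rw [hB, ← LinearMap.mem_ker, hker]
  exact Submodule.subset_span ⟨X, s, rfl⟩

theorem exists_comp_eq_of_ker_le {E F G : Type*} [AddCommGroup E] [Module ℝ E] [AddCommGroup F]
    [Module ℝ F] [AddCommGroup G] [Module ℝ G] (b : E →ₗ[ℝ] F) (f : E →ₗ[ℝ] G)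
    (h : LinearMap.ker b ≤ LinearMap.ker f) : ∃ J : F →ₗ[ℝ] G, J ∘ₗ b = f := by
  obtain ⟨l, hl⟩ := LinearMap.exists_leftInverse_of_injective
    ((LinearMap.ker b).liftQ b le_rfl) (Submodule.ker_liftQ_eq_bot _ _ _ le_rfl)
  refine ⟨(LinearMap.ker b).liftQ f h ∘ₗ l, ?_⟩
  ext x
  have h1 := congrArg (fun T => T (Submodule.Quotient.mk x)) hl
  simp only [LinearMap.comp_apply, Submodule.liftQ_apply, LinearMap.id_apply] at h1
  rw [LinearMap.comp_apply, LinearMap.comp_apply, h1, Submodule.liftQ_apply]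

end Coinvariants

/-! ### Polynomial maps -/

section PolynomialMaps

variable {E F G : Type*} [AddCommGroup E] [Module ℝ E] [AddCommGroup F] [Module ℝ F]
  [AddCommGroup G] [Module ℝ G]

theorem IsPolynomialOfDegreeLE.comp_linear {f : E → F} {d : ℕ} (hf : IsPolynomialOfDegreeLE f d)
    (T : G →ₗ[ℝ] E) : IsPolynomialOfDegreeLE (fun x => f (T x)) d := by
  obtain ⟨m, hm⟩ := hf
  exact ⟨fun k => (m k).compLinearMap fun _ => T, fun x => by simp [hm]⟩

theorem IsPolynomialOfDegreeLE.linear_comp {f : E → F} {d : ℕ} (hf : IsPolynomialOfDegreeLE f d)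
    (T : F →ₗ[ℝ] G) : IsPolynomialOfDegreeLE (fun x => T (f x)) d := by
  obtain ⟨m, hm⟩ := hf
  exact ⟨fun k => T.compMultilinearMap (m k), fun x => by simp [hm]⟩

theorem IsPolynomialOfDegreeLE.const_add {f : E → F} {d : ℕ} (hf : IsPolynomialOfDegreeLE f d)
    (c : F) : IsPolynomialOfDegreeLE (fun x => c + f x) d := by
  obtain ⟨m, hm⟩ := hf
  refine ⟨Function.update m 0 (MultilinearMap.constOfIsEmpty ℝ _ c + m 0), fun x => ?_⟩
  beta_reduce
  rw [hm, Finset.sum_range_succ', Finset.sum_range_succ' _ d]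
  simp
  abel

theorem exists_polynomial_multilinear_line {k : ℕ} (m : MultilinearMap ℝ (fun _ : Fin k => E) ℝ)
    (x y : E) : ∃ P : Polynomial ℝ, ∀ t : ℝ, m (fun _ => x + t • y) = P.eval t := by
  classical
  refine ⟨∑ s : Finset (Fin k), Polynomial.C (m (s.piecewise (fun _ => y) fun _ => x)) *
    Polynomial.X ^ s.card, fun t => ?_⟩
  have h : (fun _ : Fin k => x + t • y) = (fun _ => t • y) + fun _ => x := by
    funext j
    simp [add_comm]
  rw [h, MultilinearMap.map_add_univ, Polynomial.eval_finsetSum]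
  refine Finset.sum_congr rfl fun s _ => ?_
  have h2 : s.piecewise (fun _ => t • y) (fun _ : Fin k => x) =
      s.piecewise (fun i => (fun _ => t) i • (s.piecewise (fun _ => y) fun _ => x) i)
        (s.piecewise (fun _ => y) fun _ => x) := by
    funext j
    by_cases hj : j ∈ s <;> simp [hj]
  rw [h2, MultilinearMap.map_piecewise_smul, Finset.prod_const, smul_eq_mul, Polynomial.eval_mul,
    Polynomial.eval_C, Polynomial.eval_pow, Polynomial.eval_X, mul_comm]

/-- A real polynomial map restricts to a polynomial on each line. -/
theorem IsPolynomialOfDegreeLE.exists_polynomial_line {f : E → ℝ} {d : ℕ}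
    (hf : IsPolynomialOfDegreeLE f d) (x y : E) :
    ∃ P : Polynomial ℝ, ∀ t : ℝ, f (x + t • y) = P.eval t := by
  obtain ⟨m, hm⟩ := hf
  choose P hP using fun k => exists_polynomial_multilinear_line (m k) x y
  refine ⟨∑ k ∈ Finset.range (d + 1), P k, fun t => ?_⟩
  rw [hm, Polynomial.eval_finsetSum]
  exact Finset.sum_congr rfl fun k _ => hP k t

/-- The homogeneous components of a polynomial are determined by its values. -/
theorem eq_zero_of_forall_sum_pow_smul_eq_zero [FiniteDimensional ℝ F] {d : ℕ} {a : ℕ → F}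
    (h : ∀ t : ℝ, ∑ k ∈ Finset.range (d + 1), t ^ k • a k = 0) {k : ℕ} (hk : k ≤ d) : a k = 0 := by
  refine eq_of_forall_dual fun ℓ => ?_
  let P : Polynomial ℝ := ∑ j ∈ Finset.range (d + 1),
    Polynomial.C (ℓ (a j)) * Polynomial.X ^ j
  have hP : P = 0 := by
    refine Polynomial.funext fun t => ?_
    have h1 := congrArg ℓ (h t)
    rw [map_sum, map_zero] at h1
    rw [Polynomial.eval_zero, ← h1, Polynomial.eval_finsetSum]
    refine Finset.sum_congr rfl fun j _ => ?_
    rw [Polynomial.eval_mul, Polynomial.eval_C, Polynomial.eval_pow, Polynomial.eval_X, map_smul,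
      smul_eq_mul, mul_comm]
  have h2 : P.coeff k = ℓ (a k) := by
    simp only [P, Polynomial.finsetSum_coeff, Polynomial.coeff_C_mul_X_pow]
    rw [Finset.sum_ite_eq, if_pos (Finset.mem_range.mpr (by omega))]
  rw [← h2, hP, map_zero, Polynomial.coeff_zero]

end PolynomialMaps

/-! ### Coadjoint orbits of a semidirect product -/

section Coadjoint

variable {L M : Type*} [LieRing L] [LieAlgebra ℝ L] [AddCommGroup M] [Module ℝ M]
  [FiniteDimensional ℝ M] [LieRingModule L M] [LieModule ℝ L M]

theorem expUnit_mem_integratedGroup (x : L) :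
    expUnit (LieModule.toEnd ℝ L M x) ∈ integratedGroup L M :=
  Subgroup.subset_closure ⟨x, rfl⟩

/-- The generators of the integrated group are stable under inversion, so that an induction only
has to consider left multiplication by exponentials. -/
theorem integratedGroup_induction {p : M → Prop} (h : ∀ (x : L) v, p v →
    p (expEnd (LieModule.toEnd ℝ L M x) v)) {u : (Module.End ℝ M)ˣ} (hu : u ∈ integratedGroup L M) :
    ∀ v, p v → p ((u : Module.End ℝ M) v) := by
  induction hu using Subgroup.closure_induction'' with
  | mem u hu =>
    obtain ⟨x, hx⟩ := hu
    intro v hv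
    rw [hx]
    exact h x v hv
  | inv_mem u hu =>
    obtain ⟨x, hx⟩ := hu
    intro v hv
    have : u = expUnit (LieModule.toEnd ℝ L M x) := Units.ext hx
    rw [this]
    change p (expEnd (-(LieModule.toEnd ℝ L M x)) v)
    rw [← map_neg]
    exact h (-x) v hv
  | one => exact fun v hv => hv
  | mul u w _ _ hu hw => exact fun v hv => hu _ (hw v hv)

theorem mem_coadjointOrbit_self (ξ : Module.Dual ℝ L) : ξ ∈ coadjointOrbit L ξ :=
  ⟨1, Subgroup.one_mem _, rfl⟩

variable [FiniteDimensional ℝ L]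

theorem expEnd_mem_coadjointOrbit {ξ η : Module.Dual ℝ L} (h : η ∈ coadjointOrbit L ξ) (x : L) :
    expEnd (LieModule.toEnd ℝ L (Module.Dual ℝ L) x) η ∈ coadjointOrbit L ξ := by
  obtain ⟨u, hu, rfl⟩ := h
  exact ⟨expUnit (LieModule.toEnd ℝ L (Module.Dual ℝ L) x) * u,
    Subgroup.mul_mem _ (expUnit_mem_integratedGroup x) hu, rfl⟩

theorem coadjointOrbit_induction {p : Module.Dual ℝ L → Prop} {ξ : Module.Dual ℝ L} (h₀ : p ξ)
    (h : ∀ (x : L) η, p η → p (expEnd (LieModule.toEnd ℝ L (Module.Dual ℝ L) x) η)) :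
    ∀ η ∈ coadjointOrbit L ξ, p η := by
  rintro η ⟨u, hu, rfl⟩
  exact integratedGroup_induction h hu ξ h₀

end Coadjoint

/-- The action of a Lie algebra on a module as a bilinear map. -/
def lieBilin (L M : Type*) [LieRing L] [LieAlgebra ℝ L] [AddCommGroup M] [Module ℝ M]
    [LieRingModule L M] [LieModule ℝ L M] : L →ₗ[ℝ] M →ₗ[ℝ] M :=
  LinearMap.mk₂ ℝ (fun X m => ⁅X, m⁆) (fun X Y m => add_lie X Y m) (fun a X m => smul_lie a X m)
    (fun X m m' => lie_add X m m') (fun a X m => lie_smul a X m)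

@[simp] theorem lieBilin_apply {L M : Type*} [LieRing L] [LieAlgebra ℝ L] [AddCommGroup M]
    [Module ℝ M] [LieRingModule L M] [LieModule ℝ L M] (X : L) (m : M) :
    lieBilin L M X m = ⁅X, m⁆ := rfl

section SemidirectDual

variable {g V : Type*} [LieRing g] [LieAlgebra ℝ g] [FiniteDimensional ℝ g]
  [AddCommGroup V] [Module ℝ V] [FiniteDimensional ℝ V] [LieRingModule g V] [LieModule ℝ g V]

instance : FiniteDimensional ℝ (Semidirect g V) := inferInstanceAs (FiniteDimensional ℝ (g × V))

/-- The element `(X, u)` of `g ⋉ V`. -/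
def Semidirect.mk (X : g) (u : V) : Semidirect g V := ((X, u) : g × V)

/-- Restriction of linear forms on `g ⋉ V` to `g`. -/
def restrictLeft (g V : Type*) [LieRing g] [LieAlgebra ℝ g]
    [AddCommGroup V] [Module ℝ V] [LieRingModule g V] [LieModule ℝ g V] :
    Module.Dual ℝ (Semidirect g V) →ₗ[ℝ] Module.Dual ℝ g :=
  LinearMap.lcomp ℝ ℝ (LinearMap.inl ℝ g V : g →ₗ[ℝ] Semidirect g V)

/-- Restriction of linear forms on `g ⋉ V` to `V`. -/
def restrictRight (g V : Type*) [LieRing g] [LieAlgebra ℝ g]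
    [AddCommGroup V] [Module ℝ V] [LieRingModule g V] [LieModule ℝ g V] :
    Module.Dual ℝ (Semidirect g V) →ₗ[ℝ] Module.Dual ℝ V :=
  LinearMap.lcomp ℝ ℝ (LinearMap.inr ℝ g V : V →ₗ[ℝ] Semidirect g V)

/-- The linear form `(ξ, f)` on `g ⋉ V`. -/
def dualPair (g V : Type*) [LieRing g] [LieAlgebra ℝ g]
    [AddCommGroup V] [Module ℝ V] [LieRingModule g V] [LieModule ℝ g V] :
    Module.Dual ℝ g × Module.Dual ℝ V →ₗ[ℝ] Module.Dual ℝ (Semidirect g V) where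
  toFun q := (LinearMap.coprod q.1 q.2 : g × V →ₗ[ℝ] ℝ)
  map_add' q q' := by
    refine LinearMap.ext fun x => ?_
    change (q.1 + q'.1) x.1 + (q.2 + q'.2) x.2 = (q.1 x.1 + q.2 x.2) + (q'.1 x.1 + q'.2 x.2)
    simp only [LinearMap.add_apply]
    ring
  map_smul' a q := by
    refine LinearMap.ext fun x => ?_
    change (a • q.1) x.1 + (a • q.2) x.2 = a • (q.1 x.1 + q.2 x.2)
    simp only [LinearMap.smul_apply, smul_add]

omit [FiniteDimensional ℝ g] [FiniteDimensional ℝ V]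

theorem overMap_eq_dualPair (φ : Module.Dual ℝ g → Module.Dual ℝ V) (ξ : Module.Dual ℝ g) :
    overMap φ ξ = dualPair g V (ξ, φ ξ) := rfl

@[simp] theorem restrictLeft_dualPair (q : Module.Dual ℝ g × Module.Dual ℝ V) :
    restrictLeft g V (dualPair g V q) = q.1 := by
  refine LinearMap.ext fun x => ?_
  change q.1 x + q.2 0 = q.1 x
  rw [map_zero, add_zero]

@[simp] theorem restrictRight_dualPair (q : Module.Dual ℝ g × Module.Dual ℝ V) :
    restrictRight g V (dualPair g V q) = q.2 := by
  refine LinearMap.ext fun x => ?_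
  change q.1 0 + q.2 x = q.2 x
  rw [map_zero, zero_add]

theorem dualPair_restrict (η : Module.Dual ℝ (Semidirect g V)) :
    dualPair g V (restrictLeft g V η, restrictRight g V η) = η := by
  refine LinearMap.ext fun x => ?_
  refine (η.map_add (Semidirect.mk x.1 0) (Semidirect.mk 0 x.2)).symm.trans (congrArg η ?_)
  exact Prod.ext (add_zero _) (zero_add _)

/-- The linear form `Y ↦ f(Y u)` on `g`. -/
def orbitForm (f : Module.Dual ℝ V) (u : V) : Module.Dual ℝ g :=
  f ∘ₗ (lieBilin g V).flip u

@[simp] theorem orbitForm_apply (f : Module.Dual ℝ V) (u : V) (Y : g) :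
    orbitForm f u Y = f ⁅Y, u⁆ := rfl

/-- The coadjoint action of `g ⋉ V`: `(X, u)(ξ, f) = (X ξ + f(⬝ u), X f)`. -/
theorem lie_dualPair (X : g) (u : V) (ξ : Module.Dual ℝ g) (f : Module.Dual ℝ V) :
    ⁅Semidirect.mk X u, dualPair g V (ξ, f)⁆ = dualPair g V (⁅X, ξ⁆ + orbitForm f u, ⁅X, f⁆) := by
  refine LinearMap.ext fun x => ?_
  change -(ξ ⁅X, x.1⁆ + f (⁅X, x.2⁆ - ⁅x.1, u⁆)) = (-ξ ⁅X, x.1⁆ + f ⁅x.1, u⁆) + -f ⁅X, x.2⁆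
  rw [map_sub]
  ring

end SemidirectDual

section InvariantForm

variable {g : Type*} [LieRing g] [LieAlgebra ℝ g] (e : g ≃ₗ[ℝ] Module.Dual ℝ g)
  (hinv : ∀ X x y : g, e ⁅X, x⁆ y = - e x ⁅X, y⁆)

include hinv

theorem lie_equiv_dual (X x : g) : e ⁅X, x⁆ = ⁅X, e x⁆ := LinearMap.ext fun y => hinv X x y

variable [FiniteDimensional ℝ g]

theorem equiv_dual_expEnd (X x : g) : e (expEnd (LieModule.toEnd ℝ g g X) x) =
    expEnd (LieModule.toEnd ℝ g _ X) (e x) :=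
  map_expEnd e.toLinearMap (fun x => lie_equiv_dual e hinv X x) x

/-- The quadratic form on `g*` that corresponds to `e` is constant on coadjoint orbits. -/
theorem apply_symm_of_mem_coadjointOrbit {ξ η : Module.Dual ℝ g} (h : η ∈ coadjointOrbit g ξ) :
    η (e.symm η) = ξ (e.symm ξ) := by
  let B : Module.Dual ℝ g →ₗ[ℝ] Module.Dual ℝ g →ₗ[ℝ] ℝ := LinearMap.lcomp ℝ ℝ e.symm.toLinearMap
  refine coadjointOrbit_induction (p := fun η => η (e.symm η) = ξ (e.symm ξ)) rfl ?_ η h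
  intro X η hη
  rw [← hη]
  refine bilin_expEnd_expEnd (B := B) (fun v w => ?_) η η
  change - v ⁅X, e.symm w⁆ = - v (e.symm ⁅X, w⁆)
  congr 2
  rw [LinearEquiv.eq_symm_apply, lie_equiv_dual e hinv, LinearEquiv.apply_symm_apply]

end InvariantForm

section OrbitCondition

variable {g V : Type*} [LieRing g] [LieAlgebra ℝ g] [FiniteDimensional ℝ g]
  [AddCommGroup V] [Module ℝ V] [FiniteDimensional ℝ V] [LieRingModule g V] [LieModule ℝ g V]

theorem expEnd_mk_zero_dualPair (X : g) (ξ : Module.Dual ℝ g) (f : Module.Dual ℝ V) :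
    expEnd (LieModule.toEnd ℝ (Semidirect g V) _ (Semidirect.mk X 0)) (dualPair g V (ξ, f)) =
      dualPair g V (expEnd (LieModule.toEnd ℝ g _ X) ξ, expEnd (LieModule.toEnd ℝ g _ X) f) := by
  have h : ∀ η : Module.Dual ℝ (Semidirect g V), ⁅(Semidirect.mk X 0 : Semidirect g V), η⁆ =
      dualPair g V (⁅X, restrictLeft g V η⁆, ⁅X, restrictRight g V η⁆) := by
    intro η
    conv_lhs => rw [← dualPair_restrict η, lie_dualPair]
    congr 3
    refine add_eq_left.mpr (LinearMap.ext fun Y => ?_)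
    simp
  rw [← dualPair_restrict (expEnd _ _)]
  congr 2
  · rw [map_expEnd (restrictLeft g V) (A' := LieModule.toEnd ℝ g _ X) fun η => ?_]
    · simp
    · rw [LieModule.toEnd_apply_apply, h, restrictLeft_dualPair]
      rfl
  · rw [map_expEnd (restrictRight g V) (A' := LieModule.toEnd ℝ g _ X) fun η => ?_]
    · simp
    · rw [LieModule.toEnd_apply_apply, h, restrictRight_dualPair]
      rfl

theorem expEnd_mk_zero_left_dualPair (u : V) (ξ : Module.Dual ℝ g) (f : Module.Dual ℝ V) :
    expEnd (LieModule.toEnd ℝ (Semidirect g V) _ (Semidirect.mk 0 u)) (dualPair g V (ξ, f)) =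
      dualPair g V (ξ + orbitForm f u, f) := by
  have h : ∀ (ξ : Module.Dual ℝ g) (f : Module.Dual ℝ V),
      ⁅(Semidirect.mk 0 u : Semidirect g V), dualPair g V (ξ, f)⁆ =
      dualPair g V (orbitForm f u, 0) := by
    intro ξ f
    rw [lie_dualPair]
    simp
  rw [expEnd_apply_of_sq_eq_zero, LieModule.toEnd_apply_apply, h, ← map_add]
  · simp
  · rw [LieModule.toEnd_apply_apply, LieModule.toEnd_apply_apply, h, h]
    have : (orbitForm (0 : Module.Dual ℝ V) u : Module.Dual ℝ g) = 0 := by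
      refine LinearMap.ext fun Y => ?_
      simp
    rw [this]
    exact map_zero _

variable {φ : Module.Dual ℝ g → Module.Dual ℝ V}
  (hφ : ∀ ξ, overMap φ '' coadjointOrbit g ξ = coadjointOrbit (Semidirect g V) (overMap φ ξ))

include hφ

/-- The orbit condition forces the equivariance of `φ`. -/
theorem map_expEnd_of_image_orbit (X : g) (ξ : Module.Dual ℝ g) :
    φ (expEnd (LieModule.toEnd ℝ g _ X) ξ) = expEnd (LieModule.toEnd ℝ g _ X) (φ ξ) := by
  have h := expEnd_mem_coadjointOrbit (mem_coadjointOrbit_self (overMap φ ξ)) (Semidirect.mk X 0)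
  rw [← hφ, overMap_eq_dualPair, expEnd_mk_zero_dualPair] at h
  obtain ⟨η, -, hη⟩ := h
  rw [overMap_eq_dualPair] at hη
  have h1 := congrArg (restrictLeft g V) hη
  have h2 := congrArg (restrictRight g V) hη
  simp only [restrictLeft_dualPair, restrictRight_dualPair] at h1 h2
  rw [← h1, h2]

/-- The orbit condition forces the orbit of `ξ` to contain its translates by the forms
`Y ↦ f(Y u)`, where `f = φ ξ`. -/
theorem add_orbitForm_mem_coadjointOrbit (ξ : Module.Dual ℝ g) (u : V) :
    ξ + orbitForm (φ ξ) u ∈ coadjointOrbit g ξ := by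
  have h := expEnd_mem_coadjointOrbit (mem_coadjointOrbit_self (overMap φ ξ)) (Semidirect.mk 0 u)
  rw [← hφ, overMap_eq_dualPair, expEnd_mk_zero_left_dualPair] at h
  obtain ⟨η, hη', hη⟩ := h
  rw [overMap_eq_dualPair] at hη
  have h1 := congrArg (restrictLeft g V) hη
  simp only [restrictLeft_dualPair] at h1
  rwa [← h1]

variable (e : g ≃ₗ[ℝ] Module.Dual ℝ g) (hinv : ∀ X x y : g, e ⁅X, x⁆ y = - e x ⁅X, y⁆)

include hinv in
/-- The orbit condition forces the orthogonal of the stabilizer of `φ ξ` to be totally isotropic: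
the line `ξ + t f(⬝ u)`, `f = φ ξ`, lies in the coadjoint orbit, where the quadratic form is
constant. -/
theorem isotropic_of_image_orbit (ξ : Module.Dual ℝ g) (w : g)
    (hw : ∀ Y : g, ⁅Y, φ ξ⁆ = 0 → e w Y = 0) : e w w = 0 := by
  let D : g →ₗ[ℝ] Module.Dual ℝ V := (lieBilin g _).flip (φ ξ)
  obtain ⟨J, hJ⟩ := exists_comp_eq_of_ker_le D (e w) fun Y hY => hw Y hY
  obtain ⟨u, rfl⟩ := (Module.evalEquiv ℝ V).surjective J
  have h1 : orbitForm (φ ξ) u = - e w := by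
    rw [← hJ]
    refine LinearMap.ext fun Y => ?_
    simp [D]
  have h2 : orbitForm (φ ξ) (-u) = e w := by
    rw [← neg_eq_iff_eq_neg.mpr h1]
    refine LinearMap.ext fun Y => ?_
    simp
  have h3 := apply_symm_of_mem_coadjointOrbit e hinv (add_orbitForm_mem_coadjointOrbit hφ ξ u)
  have h4 := apply_symm_of_mem_coadjointOrbit e hinv (add_orbitForm_mem_coadjointOrbit hφ ξ (-u))
  rw [h1] at h3
  rw [h2] at h4
  simp only [map_add, map_neg, LinearMap.add_apply, LinearMap.neg_apply,
    LinearEquiv.symm_apply_apply] at h3 h4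
  linarith

end OrbitCondition

/-! ### Root decompositions and vectors annihilated by a Cartan subalgebra -/

/-- The part of a root space decomposition that is needed: a commutative subspace `H` of the Lie
algebra, an element `h₀` of `H`, and eigenvectors `x i` of `ad h₀` with distinct nonzero eigenvalues
which together with `H` span the Lie algebra, each of them being part of an `sl₂`-triple
`(h, x i, c x j)` with `h ∈ H`. -/
structure IsRootDecomposition {g ι : Type*} [LieRing g] [LieAlgebra ℝ g] (H : Submodule ℝ g)
    (h₀ : g) (lam : ι → ℝ) (x : ι → g) : Prop where
  mem : h₀ ∈ H
  lie_eq_zero : ∀ h ∈ H, ∀ h' ∈ H, ⁅h, h'⁆ = 0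
  lie_root : ∀ i, ⁅h₀, x i⁆ = lam i • x i
  ne_zero : ∀ i, lam i ≠ 0
  injective : Function.Injective lam
  sup_span : H ⊔ Submodule.span ℝ (Set.range x) = ⊤
  sl2 : ∀ i, ∃ j, ∃ c : ℝ, ∃ h ∈ H, IsSl2Triple h (x i) (c • x j)

namespace IsRootDecomposition

variable {g ι : Type*} [LieRing g] [LieAlgebra ℝ g] {H : Submodule ℝ g} {h₀ : g} {lam : ι → ℝ}
  {x : ι → g}

theorem exists_decomp (D : IsRootDecomposition H h₀ lam x) (Y : g) :
    ∃ h ∈ H, ∃ c : ι →₀ ℝ, Y = h + c.sum fun i a => a • x i := by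
  have h : Y ∈ H ⊔ Submodule.span ℝ (Set.range x) := by
    rw [D.sup_span]
    trivial
  obtain ⟨y, hy, z, hz, rfl⟩ := Submodule.mem_sup.mp h
  obtain ⟨c, rfl⟩ := Finsupp.mem_span_range_iff_exists_finsupp.mp hz
  exact ⟨y, hy, c, rfl⟩

theorem exists_eq_lie_add (D : IsRootDecomposition H h₀ lam x) (Y : g) :
    ∃ X : g, ∃ h ∈ H, Y = ⁅X, h₀⁆ + h := by
  obtain ⟨h, hh, c, rfl⟩ := D.exists_decomp Y
  refine ⟨c.sum fun i a => (-(a * (lam i)⁻¹)) • x i, h, hh, ?_⟩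
  rw [add_comm, Finsupp.sum, Finsupp.sum, ← LieModule.toEnd_apply_apply ℝ]
  change _ = (lieBilin g g).flip h₀ _ + h
  rw [map_sum]
  congr 1
  refine Finset.sum_congr rfl fun i _ => ?_
  rw [LinearMap.flip_apply, lieBilin_apply, smul_lie, ← lie_skew, D.lie_root, smul_neg, neg_smul,
    neg_neg, smul_smul, mul_assoc, inv_mul_cancel₀ (D.ne_zero i), mul_one]

theorem lam_eq_neg (D : IsRootDecomposition H h₀ lam x) {i j : ι} {c : ℝ} {h : g} (hh : h ∈ H)
    (t : IsSl2Triple h (x i) (c • x j)) : lam j = - lam i := by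
  have h1 : ⁅h₀, c • x j⁆ = lam j • (c • x j) := by
    rw [lie_smul, D.lie_root, smul_comm]
  obtain ⟨y, hy⟩ : ∃ y, y = c • x j := ⟨_, rfl⟩
  rw [← hy] at t h1
  have h2 : ⁅h₀, ⁅x i, y⁆⁆ = (lam i + lam j) • h := by
    rw [leibniz_lie, h1, D.lie_root, smul_lie, lie_smul, t.lie_e_f, add_smul]
  rw [t.lie_e_f, D.lie_eq_zero _ D.mem _ hh] at h2
  have := (smul_eq_zero.mp h2.symm).resolve_right t.h_ne_zero
  linarith

section Form

variable (D : IsRootDecomposition H h₀ lam x) (e : g ≃ₗ[ℝ] Module.Dual ℝ g)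
  (hinv : ∀ X x y : g, e ⁅X, x⁆ y = - e x ⁅X, y⁆)

include D hinv

theorem form_root_root {i k : ι} (h : lam k ≠ - lam i) : e (x i) (x k) = 0 := by
  have h1 := hinv h₀ (x i) (x k)
  rw [D.lie_root, D.lie_root, map_smul, LinearMap.smul_apply, map_smul, smul_eq_mul,
    smul_eq_mul] at h1
  have h2 : (lam i + lam k) * e (x i) (x k) = 0 := by linarith
  exact (mul_eq_zero.mp h2).resolve_left fun h3 => h (by linarith)

theorem form_root_cartan (i : ι) {h : g} (hh : h ∈ H) : e (x i) h = 0 := by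
  have h1 := hinv h₀ (x i) h
  rw [D.lie_root, D.lie_eq_zero _ D.mem _ hh, map_smul, LinearMap.smul_apply, map_zero, neg_zero,
    smul_eq_mul] at h1
  exact (mul_eq_zero.mp h1).resolve_left (D.ne_zero i)

/-- Only the component along the opposite root vector contributes to the form. -/
theorem form_root_decomp {i j : ι} (hij : lam j = - lam i) {h : g} (hh : h ∈ H) (c : ι →₀ ℝ) :
    e (x i) (h + c.sum fun k a => a • x k) = c j * e (x i) (x j) := by
  rw [map_add, form_root_cartan D e hinv i hh, zero_add, Finsupp.sum, map_sum,
    Finset.sum_eq_single j]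
  · rw [map_smul, smul_eq_mul]
  · intro k _ hk
    rw [map_smul, form_root_root D e hinv, smul_zero]
    exact fun h => hk (D.injective (h.trans hij.symm))
  · intro hj
    rw [Finsupp.notMem_support_iff.mp hj, zero_smul, map_zero]

theorem form_root_opposite_ne_zero {i j : ι} {c : ℝ} {h : g} (hh : h ∈ H)
    (t : IsSl2Triple h (x i) (c • x j)) : e (x i) (x j) ≠ 0 := by
  intro h0
  apply t.e_ne_zero
  apply e.injective
  rw [map_zero]
  refine LinearMap.ext fun Y => ?_
  obtain ⟨y, hy, a, rfl⟩ := D.exists_decomp Y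
  rw [form_root_decomp D e hinv (D.lam_eq_neg hh t) hy, h0, mul_zero, LinearMap.zero_apply]

end Form

variable {M : Type*} [AddCommGroup M] [Module ℝ M] [FiniteDimensional ℝ M]
  [LieRingModule g M] [LieModule ℝ g M]

/-- A vector annihilated by `H` whose stabilizer has a totally isotropic orthogonal is invariant
under the whole Lie algebra. Otherwise `x i v ≠ 0` for some `i`, hence also `x j v ≠ 0` for the
opposite root vector by `sl₂`-theory; as the `x k v` have distinct weights, no element of the
stabilizer has an `x i` or `x j` component, so that `x i + x j` is orthogonal to the stabilizer
without being isotropic. -/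
theorem lie_eq_zero_of_isotropic (D : IsRootDecomposition H h₀ lam x)
    (e : g ≃ₗ[ℝ] Module.Dual ℝ g) (he : ∀ x y, e x y = e y x)
    (hinv : ∀ X x y : g, e ⁅X, x⁆ y = - e x ⁅X, y⁆) (v : M) (hv : ∀ h ∈ H, ⁅h, v⁆ = 0)
    (hiso : ∀ w : g, (∀ Y : g, ⁅Y, v⁆ = 0 → e w Y = 0) → e w w = 0) (Y : g) : ⁅Y, v⁆ = 0 := by
  -- Elements of the stabilizer have no component along a root vector that moves `v`.
  have hcomp : ∀ y ∈ H, ∀ c : ι →₀ ℝ, ⁅y + c.sum fun k a => a • x k, v⁆ = 0 →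
      ∀ k, ⁅x k, v⁆ ≠ 0 → c k = 0 := by
    classical
    intro y hy c hc k hk
    rw [add_lie, hv y hy, zero_add, Finsupp.sum] at hc
    change (lieBilin g M).flip v _ = 0 at hc
    rw [map_sum] at hc
    by_contra hck
    have hind := (Module.End.eigenspaces_iSupIndep (LieModule.toEnd ℝ g M h₀)).comp D.injective
    have h1 := (iSupIndep_iff_finsetSum_eq_zero_imp_eq_zero _).mp hind c.support
      (fun k => c k • ⁅x k, v⁆) (fun k _ => Submodule.smul_mem _ _ ?_) ?_ k
      (Finsupp.mem_support_iff.mpr hck)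
    · exact (smul_ne_zero hck hk) h1
    · rw [Function.comp_apply, Module.End.mem_eigenspace_iff, LieModule.toEnd_apply_apply,
        leibniz_lie, D.lie_root, hv _ D.mem, lie_zero, add_zero, smul_lie]
    · rw [← hc]
      exact Finset.sum_congr rfl fun k _ => by simp
  have hroot : ∀ i, ⁅x i, v⁆ = 0 := by
    intro i
    by_contra hi
    obtain ⟨j, a, h, hh, t⟩ := D.sl2 i
    have hv0 : v ≠ 0 := by
      rintro rfl
      exact hi (lie_zero _)
    -- A primitive vector of weight `0` for the opposite triple would also be annihilated by `x i`.
    have hj : ⁅x j, v⁆ ≠ 0 := by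
      intro hj
      have P : t.symm.HasPrimitiveVectorWith v (0 : ℝ) :=
        ⟨hv0, by rw [neg_lie, hv h hh, neg_zero, zero_smul], by rw [smul_lie, hj, smul_zero]⟩
      have := P.pow_toEnd_f_eq_zero_of_eq_nat (n := 0) (by simp)
      rw [zero_add, pow_one] at this
      exact hi this
    have hij := D.lam_eq_neg hh t
    have hji : lam i = - lam j := by linarith
    have h1 : e (x i + x j) (x i + x j) = 0 := by
      refine hiso _ fun Y hY => ?_
      obtain ⟨y, hy, c, rfl⟩ := D.exists_decomp Y
      rw [map_add e, LinearMap.add_apply, form_root_decomp D e hinv hij hy,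
        form_root_decomp D e hinv hji hy, hcomp y hy c hY i hi, hcomp y hy c hY j hj]
      simp
    have h2 : e (x i) (x i) = 0 :=
      form_root_root D e hinv fun h => D.ne_zero i (by linarith)
    have h3 : e (x j) (x j) = 0 :=
      form_root_root D e hinv fun h => D.ne_zero j (by linarith)
    rw [map_add, map_add, LinearMap.add_apply, LinearMap.add_apply, h2, h3,
      he (x j) (x i)] at h1
    exact form_root_opposite_ne_zero D e hinv hh t (by linarith)
  obtain ⟨y, hy, c, rfl⟩ := D.exists_decomp Y
  rw [add_lie, hv y hy, zero_add]
  change (lieBilin g M).flip v _ = 0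
  rw [Finsupp.sum, map_sum]
  refine Finset.sum_eq_zero fun k _ => ?_
  rw [LinearMap.flip_apply, lieBilin_apply, smul_lie, hroot, smul_zero]

end IsRootDecomposition

/-! ### The values of `φ` are invariant -/

section Invariance

variable {g V ι : Type*} [LieRing g] [LieAlgebra ℝ g] [FiniteDimensional ℝ g]
  [AddCommGroup V] [Module ℝ V] [FiniteDimensional ℝ V] [LieRingModule g V] [LieModule ℝ g V]
  {H : Submodule ℝ g} {h₀ : g} {lam : ι → ℝ} {x : ι → g} (D : IsRootDecomposition H h₀ lam x)
  (e : g ≃ₗ[ℝ] Module.Dual ℝ g) (he : ∀ x y, e x y = e y x)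
  (hinv : ∀ X x y : g, e ⁅X, x⁆ y = - e x ⁅X, y⁆)
  {φ : Module.Dual ℝ g → Module.Dual ℝ V}
  (hφ : ∀ ξ, overMap φ '' coadjointOrbit g ξ = coadjointOrbit (Semidirect g V) (overMap φ ξ))

include D e he hinv hφ

theorem lie_eq_zero_of_mem_cartan {z : g} (hz : z ∈ H) (Y : g) : ⁅Y, φ (e z)⁆ = 0 := by
  refine D.lie_eq_zero_of_isotropic e he hinv _ (fun h hh => ?_)
    (isotropic_of_image_orbit hφ e hinv (e z)) Y
  refine eq_zero_of_forall_expEnd_smul_eq (A := LieModule.toEnd ℝ g (Module.Dual ℝ V) h) fun t => ?_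
  rw [← map_smul, ← map_expEnd_of_image_orbit hφ, expEnd_apply_of_eq_zero]
  rw [LieModule.toEnd_apply_apply, smul_lie, ← lie_equiv_dual e hinv, D.lie_eq_zero _ hh _ hz,
    map_zero, smul_zero]

/-- A polynomial map that satisfies the orbit condition takes invariant values: it does so on the
translates of `H`, which cover a neighbourhood of `h₀`. -/
theorem lie_eq_zero_of_image_orbit {d : ℕ} (hd : IsPolynomialOfDegreeLE φ d) (Y : g)
    (ξ : Module.Dual ℝ g) : ⁅Y, φ ξ⁆ = 0 := by
  have h1 := eventually_exists_expEnd_line (lieBilin g (Module.Dual ℝ g)) (H.map e.toLinearMap)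
    (e h₀) ⟨h₀, D.mem, rfl⟩ (fun η => by
      obtain ⟨X, h, hh, hX⟩ := D.exists_eq_lie_add (e.symm η)
      refine ⟨X, e h, ⟨h, hh, rfl⟩, ?_⟩
      rw [lieBilin_apply, ← lie_equiv_dual e hinv, ← map_add, ← hX, e.apply_symm_apply])
    (ξ - e h₀)
  refine LinearMap.ext fun u => ?_
  let T : Module.Dual ℝ V →ₗ[ℝ] ℝ := LinearMap.applyₗ u ∘ₗ lieBilin g (Module.Dual ℝ V) Y
  obtain ⟨P, hP⟩ := (hd.linear_comp T).exists_polynomial_line (e h₀) (ξ - e h₀)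
  have hP0 : P = 0 := by
    refine Polynomial.eq_zero_of_infinite_isRoot P (infinite_of_mem_nhds (0 : ℝ) ?_)
    filter_upwards [h1] with t ht
    obtain ⟨X, _, ⟨z, hz, rfl⟩, hX⟩ := ht
    change P.eval t = 0
    have h2 : φ (expEnd (lieBilin g (Module.Dual ℝ g) X) (e z)) = φ (e z) :=
      (map_expEnd_of_image_orbit hφ X (e z)).trans
        (expEnd_apply_of_eq_zero (lie_eq_zero_of_mem_cartan D e he hinv hφ hz X))
    rw [← hP, hX]
    exact (congrArg T h2).trans
      (congrArg (fun f : Module.Dual ℝ V => f u) (lie_eq_zero_of_mem_cartan D e he hinv hφ hz Y))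
  have h3 := hP 1
  rw [hP0, Polynomial.eval_zero, one_smul, add_sub_cancel] at h3
  exact h3

end Invariance

/-! ### Invariant polynomial maps and symmetric powers -/

section Factorization

variable {g W : Type*} [LieRing g] [LieAlgebra ℝ g] [FiniteDimensional ℝ g]
  [AddCommGroup W] [Module ℝ W] [FiniteDimensional ℝ W]
  (e : g ≃ₗ[ℝ] Module.Dual ℝ g) (he : ∀ x y, e x y = e y x)
  (hinv : ∀ X x y : g, e ⁅X, x⁆ y = - e x ⁅X, y⁆)

include e he in
theorem map_lie_eq_zero_of_expEnd {k : ℕ} (F : SymPow g g k →ₗ[ℝ] W)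
    (h : ∀ X x : g, F (symPower k (expEnd (LieModule.toEnd ℝ g g X) x)) = F (symPower k x))
    (X : g) (s : SymPow g g k) : F ⁅X, s⁆ = 0 := by
  have h1 : F ∘ₗ LieModule.toEnd ℝ g (SymPow g g k) X = 0 := by
    refine linearMap_ext_symPower fun x => eq_of_forall_dual fun ℓ => ?_
    have h2 := hasDerivAt_symPower_expEnd e he k (ℓ ∘ₗ F) X x 0
    simp only [← map_smul, LinearMap.comp_apply, h] at h2
    have h3 := h2.unique (hasDerivAt_const (0 : ℝ) (ℓ (F (symPower k x))))
    rw [expEnd_apply_of_eq_zero (by simp)] at h3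
    simpa using h3
  exact congrArg (fun T => T s) h1

include e he in
theorem map_symPower_expEnd_of_map_lie {k : ℕ} (F : SymPow g g k →ₗ[ℝ] W)
    (h : ∀ (X : g) s, F ⁅X, s⁆ = 0) (X x : g) :
    F (symPower k (expEnd (LieModule.toEnd ℝ g g X) x)) = F (symPower k x) := by
  refine eq_of_forall_dual fun ℓ => ?_
  have h1 : ∀ t : ℝ, HasDerivAt
      (fun s : ℝ => ℓ (F (symPower k (expEnd (s • LieModule.toEnd ℝ g g X) x)))) 0 t := by
    intro t
    have h2 := hasDerivAt_symPower_expEnd e he k (ℓ ∘ₗ F) X x t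
    simp only [LinearMap.comp_apply, h, map_zero] at h2
    exact h2
  have h3 := is_const_of_deriv_eq_zero (fun t => (h1 t).differentiableAt)
    (fun t => (h1 t).deriv) 1 0
  rw [one_smul] at h3
  rw [h3, expEnd_apply_of_eq_zero (by simp)]

include e he hinv in
/-- An invariant polynomial map factors, up to a constant, through the coinvariants of the symmetric
powers. -/
theorem exists_sum_symPower_eq {φ : Module.Dual ℝ g → W} {p : ℕ} (hd : IsPolynomialOfDegreeLE φ p)
    (hφ : ∀ (X : g) ξ, φ (expEnd (LieModule.toEnd ℝ g _ X) ξ) = φ ξ) :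
    ∃ (c : W) (F : (k : Fin p) → SymPow g g (k + 1) →ₗ[ℝ] W),
      (∀ k (X : g) s, F k ⁅X, s⁆ = 0) ∧
        ∀ ξ, φ ξ = c + ∑ k, F k (symPower (k + 1) (e.symm ξ)) := by
  obtain ⟨m, hm⟩ := hd
  choose F hF using fun k => exists_linearMap_symPower_eq e he k
    ((m k).compLinearMap fun _ => e.toLinearMap)
  have hφF : ∀ x, φ (e x) = ∑ k ∈ Finset.range (p + 1), F k (symPower k x) := by
    intro x
    rw [hm]
    exact Finset.sum_congr rfl fun k _ => (hF k x).symm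
  have hhom : ∀ k x (t : ℝ), F k (symPower k (t • x)) = t ^ k • F k (symPower k x) := by
    intro k x t
    have : symPower k (t • x) = t ^ k • symPower k x := by
      refine Subtype.ext ?_
      simp [smul_pow]
    rw [this, map_smul]
  have hcomp : ∀ k ≤ p, ∀ X x : g,
      F k (symPower k (expEnd (LieModule.toEnd ℝ g g X) x)) = F k (symPower k x) := by
    intro k hk X x
    rw [← sub_eq_zero]
    refine eq_zero_of_forall_sum_pow_smul_eq_zero (d := p)
      (a := fun k => F k (symPower k (expEnd (LieModule.toEnd ℝ g g X) x)) - F k (symPower k x))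
      (fun t => ?_) hk
    have h1 := hφ X (e (t • x))
    rw [← equiv_dual_expEnd e hinv, hφF, hφF, map_smul, ← sub_eq_zero,
      ← Finset.sum_sub_distrib] at h1
    rw [← h1]
    exact Finset.sum_congr rfl fun k _ => by rw [hhom, hhom, smul_sub]
  refine ⟨F 0 (symPower 0 0), fun k => F (k + 1), fun k X s =>
    map_lie_eq_zero_of_expEnd e he _ (hcomp _ (by omega)) X s, fun ξ => ?_⟩
  obtain ⟨x, rfl⟩ := e.surjective ξ
  have h0 : symPower 0 x = symPower 0 0 := Subtype.ext (by simp)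
  rw [hφF, Finset.sum_range_succ', e.symm_apply_apply, add_comm, Finset.sum_range, h0]

omit [FiniteDimensional ℝ g] [FiniteDimensional ℝ W] in
theorem isPolynomialOfDegreeLE_sum_symPower {p : ℕ}
    (G : (k : Fin p) → SymPow g g (k + 1) →ₗ[ℝ] W) :
    IsPolynomialOfDegreeLE (fun x : g => ∑ k, G k (symPower (k + 1) x)) p := by
  choose G' hG' using fun k => LinearMap.exists_extend
    (p := (SymPow g g ((k : Fin p) + 1)).toSubmodule) (G k)
  let m : (k : ℕ) → MultilinearMap ℝ (fun _ : Fin k => g) W := fun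
    | 0 => 0
    | k + 1 => if h : k < p then (G' ⟨k, h⟩).compMultilinearMap
        ((MultilinearMap.mkPiAlgebra ℝ (Fin (k + 1)) (SymmetricAlgebra ℝ g)).compLinearMap
          fun _ => SymmetricAlgebra.ι ℝ g) else 0
  refine ⟨m, fun x => ?_⟩
  rw [Finset.sum_range_succ', Finset.sum_range]
  have h0 : m 0 (fun _ => x) = 0 := rfl
  rw [h0, add_zero]
  refine Finset.sum_congr rfl fun k _ => ?_
  have h1 : m (k + 1) = (G' k).compMultilinearMap
        ((MultilinearMap.mkPiAlgebra ℝ (Fin (k + 1)) (SymmetricAlgebra ℝ g)).compLinearMap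
          fun _ => SymmetricAlgebra.ι ℝ g) := dif_pos k.2
  rw [h1, ← hG' k]
  simp
  rfl

end Factorization

/-! ### Transfer of the almost separating property -/

section Transfer

theorem closedConvHull_image_eq {E F : Type*} [AddCommGroup E] [Module ℝ E]
    [AddCommGroup F] [Module ℝ F] (A : E →ᵃ[ℝ] F) {s s' : Set E}
    (h : closedConvHull s = closedConvHull s') :
    closedConvHull (A '' s) = closedConvHull (A '' s') := by
  let _ : TopologicalSpace E := moduleTopology ℝ E
  have : IsModuleTopology ℝ E := ⟨rfl⟩
  let _ : TopologicalSpace F := moduleTopology ℝ F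
  have : IsModuleTopology ℝ F := ⟨rfl⟩
  have : IsTopologicalAddGroup F := IsModuleTopology.topologicalAddGroup ℝ _
  have hA : Continuous A := by
    have h1 : Continuous A.linear := IsModuleTopology.continuous_of_linearMap _
    have h2 : (A : E → F) = fun v => A.linear v + A 0 := A.decomp
    rw [h2]
    exact h1.add continuous_const
  have h3 : ∀ s : Set E, closedConvHull (A '' s) = closure (A '' closedConvHull s) := by
    intro s
    unfold closedConvHull
    rw [← A.image_convexHull]
    exact (closure_image_closure hA).symm
  rw [h3, h3, h]

variable {g V W : Type*} [LieRing g] [LieAlgebra ℝ g] [FiniteDimensional ℝ g]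
  [AddCommGroup V] [Module ℝ V] [FiniteDimensional ℝ V] [LieRingModule g V] [LieModule ℝ g V]
  [AddCommGroup W] [Module ℝ W] [FiniteDimensional ℝ W] [LieRingModule g W] [LieModule ℝ g W]

/-- A map with invariant values that is constant on coadjoint orbits satisfies the orbit
condition: on the forms `(ξ, f)` with `f` invariant, `(X, u)` acts as `X` does on `ξ`. -/
theorem image_orbit_of_invariant {ψ : Module.Dual ℝ g → Module.Dual ℝ W}
    (hψ : ∀ (Y : g) ξ, ⁅Y, ψ ξ⁆ = 0)
    (hexp : ∀ (X : g) ξ, ψ (expEnd (LieModule.toEnd ℝ g _ X) ξ) = ψ ξ) (ξ : Module.Dual ℝ g) :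
    overMap ψ '' coadjointOrbit g ξ = coadjointOrbit (Semidirect g W) (overMap ψ ξ) := by
  have hstep : ∀ (X : g) (u : W) (η : Module.Dual ℝ g),
      expEnd (LieModule.toEnd ℝ (Semidirect g W) _ (Semidirect.mk X u)) (overMap ψ η) =
        overMap ψ (expEnd (LieModule.toEnd ℝ g _ X) η) := by
    intro X u η
    have hu : ∀ f : Module.Dual ℝ W, (∀ Y : g, ⁅Y, f⁆ = 0) →
        (orbitForm f u : Module.Dual ℝ g) = 0 := fun f hf => LinearMap.ext fun Y =>
      neg_eq_zero.mp (congrArg (fun k : Module.Dual ℝ W => k u) (hf Y))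
    have h1 : ∀ η f, dualPair g W (η, f) =
        (dualPair g W ∘ₗ LinearMap.inl ℝ _ _) η + dualPair g W (0, f) := by
      intro η f
      rw [LinearMap.comp_apply, ← map_add]
      simp
    rw [overMap_eq_dualPair, overMap_eq_dualPair, hexp, h1, map_add, h1 (expEnd _ η)]
    congr 1
    · refine (map_expEnd (dualPair g W ∘ₗ LinearMap.inl ℝ _ _)
        (A := LieModule.toEnd ℝ g (Module.Dual ℝ g) X) (fun ζ => ?_) η).symm
      rw [LieModule.toEnd_apply_apply, LieModule.toEnd_apply_apply, LinearMap.comp_apply,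
        LinearMap.comp_apply, LinearMap.inl_apply, LinearMap.inl_apply, lie_dualPair, lie_zero,
        hu 0 fun Y => lie_zero Y, add_zero]
    · refine expEnd_apply_of_eq_zero ?_
      rw [LieModule.toEnd_apply_apply, lie_dualPair, hψ, hu _ fun Y => hψ Y η, lie_zero, add_zero]
      exact map_zero _
  apply Set.Subset.antisymm
  · rintro _ ⟨η, hη, rfl⟩
    refine coadjointOrbit_induction
      (p := fun η => overMap ψ η ∈ coadjointOrbit (Semidirect g W) (overMap ψ ξ))
      (mem_coadjointOrbit_self _) (fun X η hη => ?_) η hη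
    rw [← hstep X 0]
    exact expEnd_mem_coadjointOrbit hη _
  · refine coadjointOrbit_induction (p := fun ζ => ζ ∈ overMap ψ '' coadjointOrbit g ξ)
      ⟨ξ, mem_coadjointOrbit_self _, rfl⟩ ?_
    rintro Z _ ⟨η, hη, rfl⟩
    exact ⟨_, expEnd_mem_coadjointOrbit hη Z.1, (hstep Z.1 Z.2 η).symm⟩

/-- If `φ` is an affine function of `ψ`, then `ψ` separates at least as well as `φ`. -/
theorem IsAlmostSeparating.of_eq_add_comp {Ω : Set (Module.Dual ℝ g)}
    {φ : Module.Dual ℝ g → Module.Dual ℝ V} {ψ : Module.Dual ℝ g → Module.Dual ℝ W} {p : ℕ}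
    (h : IsAlmostSeparating Ω φ p) (hd : IsPolynomialOfDegreeLE ψ p)
    (hψ : ∀ (Y : g) ξ, ⁅Y, ψ ξ⁆ = 0)
    (hexp : ∀ (X : g) ξ, ψ (expEnd (LieModule.toEnd ℝ g _ X) ξ) = ψ ξ)
    (J : Module.Dual ℝ W →ₗ[ℝ] Module.Dual ℝ V) (c : Module.Dual ℝ V)
    (hJ : ∀ ξ, φ ξ = c + J (ψ ξ)) : IsAlmostSeparating Ω ψ p where
  degree := by
    refine ⟨hd, fun q hq => h.degree.2 ?_⟩
    have h1 := (IsPolynomialOfDegreeLE.linear_comp hq J).const_add c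
    have h2 : φ = fun ξ => c + J (ψ ξ) := funext hJ
    rw [h2]
    exact h1
  image_orbit := image_orbit_of_invariant hψ hexp
  separating ξ hξ := by
    refine (h.separating ξ hξ).subset ?_
    rintro O ⟨ξ', rfl, hO⟩
    refine ⟨ξ', rfl, ?_⟩
    let A : Module.Dual ℝ (Semidirect g W) →ᵃ[ℝ] Module.Dual ℝ (Semidirect g V) :=
      (dualPair g V ∘ₗ ((restrictLeft g W).prod (J ∘ₗ restrictRight g W))).toAffineMap +
        AffineMap.const ℝ _ (dualPair g V (0, c))
    have hA : ∀ η, A (overMap ψ η) = overMap φ η := by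
      intro η
      change dualPair g V (restrictLeft g W (overMap ψ η), J (restrictRight g W (overMap ψ η))) +
        dualPair g V (0, c) = _
      rw [overMap_eq_dualPair, overMap_eq_dualPair, restrictLeft_dualPair, restrictRight_dualPair,
        ← map_add, hJ, add_comm c]
      simp
    have hA' : ∀ s : Set (Module.Dual ℝ g), overMap φ '' s = A '' (overMap ψ '' s) := by
      intro s
      rw [Set.image_image]
      exact Set.image_congr fun η _ => (hA η).symm
    rw [hA', hA']
    exact closedConvHull_image_eq A hO

/-- If `g` admits an almost separating overalgebra, then any family of linear maps on the symmetric
powers through which all linear maps killing `g S^k(g)` factor gives another one. -/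
theorem IsAlmostSeparating.sum_symPower {ι : Type*} {H : Submodule ℝ g} {h₀ : g} {lam : ι → ℝ}
    {x : ι → g} (D : IsRootDecomposition H h₀ lam x)
    (e : g ≃ₗ[ℝ] Module.Dual ℝ g) (he : ∀ x y, e x y = e y x)
    (hinv : ∀ X x y : g, e ⁅X, x⁆ y = - e x ⁅X, y⁆)
    {Ω : Set (Module.Dual ℝ g)} {φ : Module.Dual ℝ g → Module.Dual ℝ V} {p : ℕ}
    (h : IsAlmostSeparating Ω φ p)
    (G : (k : Fin p) → SymPow g g (k + 1) →ₗ[ℝ] Module.Dual ℝ W)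
    (hG : ∀ k (X : g) s, G k ⁅X, s⁆ = 0) (hG' : ∀ k (X : g) s, ⁅X, G k s⁆ = 0)
    (hfac : ∀ F : (k : Fin p) → SymPow g g (k + 1) →ₗ[ℝ] Module.Dual ℝ V,
      (∀ k (X : g) s, F k ⁅X, s⁆ = 0) →
        ∃ J : Module.Dual ℝ W →ₗ[ℝ] Module.Dual ℝ V, ∀ k s, J (G k s) = F k s) :
    IsAlmostSeparating (V := W) Ω (fun ξ => ∑ k, G k (symPower (k + 1) (e.symm ξ))) p := by
  have hφinv := lie_eq_zero_of_image_orbit D e he hinv h.image_orbit h.degree.1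
  have hφexp : ∀ (X : g) ξ, φ (expEnd (LieModule.toEnd ℝ g _ X) ξ) = φ ξ := by
    intro X ξ
    rw [map_expEnd_of_image_orbit h.image_orbit]
    exact expEnd_apply_of_eq_zero (hφinv X ξ)
  obtain ⟨c, F, hF, hφF⟩ := exists_sum_symPower_eq e he hinv h.degree.1 hφexp
  obtain ⟨J, hJ⟩ := hfac F hF
  refine h.of_eq_add_comp
    ((isPolynomialOfDegreeLE_sum_symPower G).comp_linear e.symm.toLinearMap) ?_ ?_ J c ?_
  · intro Y ξ
    change lieBilin g (Module.Dual ℝ W) Y _ = 0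
    rw [map_sum]
    exact Finset.sum_eq_zero fun k _ => hG' k Y _
  · intro X ξ
    refine Finset.sum_congr rfl fun k _ => ?_
    obtain ⟨z, rfl⟩ := e.surjective ξ
    rw [← equiv_dual_expEnd e hinv, e.symm_apply_apply, e.symm_apply_apply]
    exact map_symPower_expEnd_of_map_lie e he (G k) (hG k) X z
  · intro ξ
    rw [hφF, map_sum]
    simp only [hJ]

end Transfer

/-! ### The universal overalgebras -/

section Universal

theorem exists_eval_eq {S F : Type*} [AddCommGroup S] [Module ℝ S] [FiniteDimensional ℝ S]
    [AddCommGroup F] [Module ℝ F] (T : S →ₗ[ℝ] F) :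
    ∃ J : Module.Dual ℝ (Module.Dual ℝ S) →ₗ[ℝ] F, ∀ s, J (Module.Dual.eval ℝ S s) = T s := by
  refine ⟨T ∘ₗ (Module.evalEquiv ℝ S).symm.toLinearMap, fun s => congrArg T ?_⟩
  exact (Module.evalEquiv ℝ S).symm_apply_apply s

theorem exists_dual_comp_proj_eq {κ S F : Type*} [Fintype κ] {M : κ → Type*}
    [∀ k, AddCommGroup (M k)] [∀ k, Module ℝ (M k)] [AddCommGroup S] [Module ℝ S]
    [AddCommGroup F] [Module ℝ F] (incl : (k : κ) → M k →ₗ[ℝ] S) (proj : (k : κ) → S →ₗ[ℝ] M k)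
    (h : ∀ k s, proj k (incl k s) = s) (h' : ∀ j k s, j ≠ k → proj j (incl k s) = 0)
    (θ : (k : κ) → M k ≃ₗ[ℝ] Module.Dual ℝ (M k)) (J : (k : κ) → M k →ₗ[ℝ] F) :
    ∃ J' : Module.Dual ℝ S →ₗ[ℝ] F, ∀ k s, J' (θ k s ∘ₗ proj k) = J k s := by
  classical
  refine ⟨∑ k, J k ∘ₗ (θ k).symm.toLinearMap ∘ₗ LinearMap.lcomp ℝ ℝ (incl k), fun k s => ?_⟩
  rw [LinearMap.sum_apply, Finset.sum_eq_single k]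
  · have h1 : (θ k s ∘ₗ proj k) ∘ₗ incl k = θ k s := LinearMap.ext fun w => by
      simp [h]
    change J k ((θ k).symm ((θ k s ∘ₗ proj k) ∘ₗ incl k)) = _
    rw [h1, LinearEquiv.symm_apply_apply]
  · intro j _ hj
    have h1 : (θ k s ∘ₗ proj k) ∘ₗ incl j = 0 := LinearMap.ext fun w => by
      simp [h' k j w hj.symm]
    change J j ((θ j).symm ((θ k s ∘ₗ proj k) ∘ₗ incl j)) = _
    rw [h1, map_zero, map_zero]
  · simp

theorem sum_proj_incl {κ S F : Type*} [Fintype κ] {M : κ → Type*}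
    [∀ k, AddCommGroup (M k)] [∀ k, Module ℝ (M k)] [AddCommGroup S] [Module ℝ S]
    [AddCommGroup F] [Module ℝ F] (incl : (k : κ) → M k →ₗ[ℝ] S) (proj : (k : κ) → S →ₗ[ℝ] M k)
    (h : ∀ k s, proj k (incl k s) = s) (h' : ∀ j k s, j ≠ k → proj j (incl k s) = 0)
    (J : (k : κ) → M k →ₗ[ℝ] F) (k : κ) (s : M k) : ∑ j, J j (proj j (incl k s)) = J k s := by
  classical
  rw [Finset.sum_eq_single k, h]
  · intro j _ hj
    rw [h' _ _ _ hj, map_zero]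
  · simp

variable {g : Type*} [LieRing g] [LieAlgebra ℝ g] [FiniteDimensional ℝ g]
  (e : g ≃ₗ[ℝ] Module.Dual ℝ g) (he : ∀ x y, e x y = e y x)
  (hinv : ∀ X x y : g, e ⁅X, x⁆ y = - e x ⁅X, y⁆)

include he hinv in
/-- Intertwining maps of the symmetric powers onto their invariants, whose kernels are spanned by
the elements `⁅X, s⁆`. -/
theorem exists_symPow_coinvariants_map (F : Type*) [AddCommGroup F] [Module ℝ F] (k : ℕ) :
    ∃ b : SymPow g g k →ₗ⁅ℝ,g⁆ SymPow g g k,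
      (∀ (X : g) s, ⁅X, b s⁆ = 0) ∧ (∀ (X : g) s, b ⁅X, s⁆ = 0) ∧
      ∀ f : SymPow g g k →ₗ[ℝ] F, (∀ (X : g) s, f ⁅X, s⁆ = 0) →
        ∃ J : SymPow g g k →ₗ[ℝ] F, ∀ s, J (b s) = f s := by
  obtain ⟨b, hb, hker⟩ := exists_lieModuleHom_ker_eq_lieSpan (symPowDual e he k)
    (symPowDual_lie e he hinv k)
  refine ⟨b, hb, fun X s => by rw [LieModuleHom.map_lie, hb], fun f hf => ?_⟩
  obtain ⟨J, hJ⟩ := exists_comp_eq_of_ker_le (b : SymPow g g k →ₗ[ℝ] SymPow g g k) f (by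
    rw [hker, lieSpan, Submodule.span_le]
    rintro _ ⟨X, s, rfl⟩
    exact hf X s)
  exact ⟨J, fun s => congrArg (fun T => T s) hJ⟩

variable {S : Type*} [AddCommGroup S] [Module ℝ S] [LieRingModule g S] [LieModule ℝ g S] {p : ℕ}
  (incl : (k : Fin p) → SymPow g g (k + 1) →ₗ[ℝ] S)
  (proj : (k : Fin p) → S →ₗ[ℝ] SymPow g g (k + 1))
  (h₁ : ∀ k s, proj k (incl k s) = s) (h₂ : ∀ j k s, j ≠ k → proj j (incl k s) = 0)
  (h₃ : ∀ k (X : g) s, ⁅X, incl k s⁆ = incl k ⁅X, s⁆)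
  (h₄ : ∀ k (X : g) s, proj k ⁅X, s⁆ = ⁅X, proj k s⁆)

include h₁ h₂ h₃ h₄ in
omit [FiniteDimensional ℝ g] in
/-- Intertwining maps of the summands with invariant values assemble to an intertwining map of the
direct sum. -/
theorem exists_sum_lieModuleHom (b : (k : Fin p) → SymPow g g (k + 1) →ₗ⁅ℝ,g⁆ SymPow g g (k + 1))
    (hb : ∀ k (X : g) s, ⁅X, b k s⁆ = 0) :
    ∃ B : S →ₗ⁅ℝ,g⁆ S, (∀ (X : g) s, ⁅X, B s⁆ = 0) ∧ ∀ k s, B (incl k s) = incl k (b k s) := by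
  let f : (k : Fin p) → SymPow g g (k + 1) →ₗ[ℝ] S := fun k =>
    incl k ∘ₗ (b k : SymPow g g (k + 1) →ₗ[ℝ] SymPow g g (k + 1))
  let B : S →ₗ[ℝ] S := ∑ k, f k ∘ₗ proj k
  have hB : ∀ s, B s = ∑ k, f k (proj k s) := fun s => LinearMap.sum_apply _ _ _
  have hBinv : ∀ (X : g) s, ⁅X, B s⁆ = 0 := by
    intro X s
    rw [hB, ← lieBilin_apply, map_sum]
    refine Finset.sum_eq_zero fun k _ => ?_
    change ⁅X, incl k (b k (proj k s))⁆ = 0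
    rw [h₃, hb, map_zero]
  have hBlie : ∀ (X : g) s, B ⁅X, s⁆ = 0 := by
    intro X s
    rw [hB]
    refine Finset.sum_eq_zero fun k _ => ?_
    change incl k (b k (proj k ⁅X, s⁆)) = 0
    rw [h₄, LieModuleHom.map_lie, hb, map_zero]
  refine ⟨{ B with map_lie' := fun {X s} => (hBlie X s).trans (hBinv X s).symm }, hBinv,
    fun k s => ?_⟩
  change B _ = _
  rw [hB, sum_proj_incl incl proj h₁ h₂ f k s]
  rfl

variable [FiniteDimensional ℝ S] {V ι : Type*} [AddCommGroup V] [Module ℝ V]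
  [FiniteDimensional ℝ V] [LieRingModule g V] [LieModule ℝ g V]
  {H : Submodule ℝ g} {h₀ : g} {lam : ι → ℝ} {x : ι → g} (D : IsRootDecomposition H h₀ lam x)
  {Ω : Set (Module.Dual ℝ g)} {φ : Module.Dual ℝ g → Module.Dual ℝ V}
  (h : IsAlmostSeparating Ω φ p)

include he hinv h₁ h₂ h₃ h₄ D h

/-- The universal overalgebra on the dual of `S = S_p(g)`; the direct sum enters only through its
inclusions and projections. -/
theorem exists_isAlmostSeparating_dual :
    ∃ b : S →ₗ⁅ℝ,g⁆ S, IsAlmostSeparating (V := Module.Dual ℝ S) Ω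
      (fun ξ => Module.Dual.eval ℝ S (b (∑ k, incl k (symPower (k + 1) (e.symm ξ))))) p := by
  choose b hb hb' hfac using fun k : Fin p =>
    exists_symPow_coinvariants_map e he hinv (Module.Dual ℝ V) (k + 1)
  obtain ⟨B, hB, hBincl⟩ := exists_sum_lieModuleHom incl proj h₁ h₂ h₃ h₄ b hb
  refine ⟨B, ?_⟩
  let G : (k : Fin p) → SymPow g g (k + 1) →ₗ[ℝ] Module.Dual ℝ (Module.Dual ℝ S) :=
    fun k => Module.Dual.eval ℝ S ∘ₗ (B : S →ₗ[ℝ] S) ∘ₗ incl k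
  have hG : ∀ k s, G k s = Module.Dual.eval ℝ S (B (incl k s)) := fun k s => rfl
  have hsum : (fun ξ => Module.Dual.eval ℝ S (B (∑ k, incl k (symPower (k + 1) (e.symm ξ))))) =
      fun ξ => ∑ k, G k (symPower (k + 1) (e.symm ξ)) := by
    funext ξ
    simp only [hG]
    rw [map_sum, map_sum]
  rw [hsum]
  refine h.sum_symPower (W := Module.Dual ℝ S) D e he hinv G ?_ ?_ ?_
  · intro k X s
    rw [hG, hBincl, hb', map_zero, map_zero]
  · intro k X s
    refine LinearMap.ext fun f => ?_
    rw [hG, Module.Dual.lie_apply, Module.Dual.eval_apply, Module.Dual.lie_apply, hB, map_zero,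
      neg_zero, neg_zero, LinearMap.zero_apply]
  · intro F hF
    choose J hJ using fun k => hfac k (F k) (hF k)
    obtain ⟨J', hJ'⟩ := exists_eval_eq (∑ k, J k ∘ₗ proj k)
    refine ⟨J', fun k s => ?_⟩
    rw [hG, hJ', hBincl, LinearMap.sum_apply, ← hJ]
    exact sum_proj_incl incl proj h₁ h₂ J k (b k s)

omit h₃ in
/-- The universal overalgebra on `S = S_p(g)` itself, for self-dual symmetric powers. -/
theorem exists_isAlmostSeparating_of_selfDual
    (θ : (k : Fin p) → SymPow g g (k + 1) ≃ₗ⁅ℝ,g⁆ Module.Dual ℝ (SymPow g g (k + 1))) :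
    ∃ b : (k : Fin p) → SymPow g g (k + 1) →ₗ⁅ℝ,g⁆ SymPow g g (k + 1),
      IsAlmostSeparating (V := S) Ω
        (fun ξ => ∑ k, θ k (b k (symPower (k + 1) (e.symm ξ))) ∘ₗ proj k) p := by
  choose b hb hb' hfac using fun k : Fin p =>
    exists_symPow_coinvariants_map e he hinv (Module.Dual ℝ V) (k + 1)
  refine ⟨b, ?_⟩
  let G : (k : Fin p) → SymPow g g (k + 1) →ₗ[ℝ] Module.Dual ℝ S := fun k =>
    LinearMap.lcomp ℝ ℝ (proj k) ∘ₗ (θ k).toLinearEquiv.toLinearMap ∘ₗ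
      (b k : SymPow g g (k + 1) →ₗ[ℝ] SymPow g g (k + 1))
  have hG : ∀ k s w, G k s w = θ k (b k s) (proj k w) := fun k s w => rfl
  have hθ0 : ∀ k, θ k 0 = 0 := fun k => (θ k).toLieModuleHom.map_zero
  refine h.sum_symPower (W := S) D e he hinv G ?_ ?_ ?_
  · intro k X s
    refine LinearMap.ext fun w => ?_
    rw [hG, hb', hθ0]
    rfl
  · intro k X s
    refine LinearMap.ext fun w => ?_
    have h5 : ⁅X, θ k (b k s)⁆ = 0 := by
      rw [← hθ0, ← hb k X s]
      exact ((θ k).toLieModuleHom.map_lie X (b k s)).symm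
    rw [Module.Dual.lie_apply, hG, h₄, ← Module.Dual.lie_apply, h5]
    rfl
  · intro F hF
    choose J hJ using fun k => hfac k (F k) (hF k)
    obtain ⟨J', hJ'⟩ := exists_dual_comp_proj_eq incl proj h₁ h₂ (fun k => (θ k).toLinearEquiv) J
    exact ⟨J', fun k s => (hJ' k (b k s)).trans (hJ k s)⟩

end Universal

/-! ### The direct sum of symmetric powers -/

section SymUpTo

variable (g : Type*) [LieRing g] [LieAlgebra ℝ g] {p : ℕ}

/-- The inclusion of the summand of degree `k + 1` into `S_p(g)`. -/
def symUpToIncl (k : Fin p) : SymPow g g (k + 1) →ₗ[ℝ] SymUpTo g p :=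
  DirectSum.lof ℝ (Fin p) (fun k => SymPow g g (k + 1)) k

/-- The projection of `S_p(g)` onto the summand of degree `k + 1`. -/
def symUpToProj (k : Fin p) : SymUpTo g p →ₗ[ℝ] SymPow g g (k + 1) :=
  DirectSum.component ℝ (Fin p) (fun k => SymPow g g (k + 1)) k

variable {g}

theorem lie_symUpToIncl (k : Fin p) (X : g) (s : SymPow g g (k + 1)) :
    ⁅X, symUpToIncl g k s⁆ = symUpToIncl g k ⁅X, s⁆ :=
  ((DirectSum.lieModuleOf ℝ (Fin p) g (fun k => SymPow g g (k + 1)) k).map_lie X s).symm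

theorem symUpToProj_lie (k : Fin p) (X : g) (s : SymUpTo g p) :
    symUpToProj g k ⁅X, s⁆ = ⁅X, symUpToProj g k s⁆ :=
  (DirectSum.lieModuleComponent ℝ (Fin p) g (fun k => SymPow g g (k + 1)) k).map_lie X s

theorem symUpToProj_incl (k : Fin p) (s : SymPow g g (k + 1)) :
    symUpToProj g k (symUpToIncl g k s) = s :=
  DirectSum.component.lof_self (M := fun k : Fin p => SymPow g g (k + 1)) ℝ k s

theorem symUpToProj_incl_of_ne (j k : Fin p) (s : SymPow g g (k + 1)) (h : j ≠ k) :
    symUpToProj g j (symUpToIncl g k s) = 0 := by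
  unfold symUpToProj symUpToIncl
  rw [DirectSum.component.of, dif_neg (Ne.symm h)]

theorem toModule_eq_sum (f : (k : Fin p) → Module.Dual ℝ (SymPow g g (k + 1))) :
    DirectSum.toModule ℝ (Fin p) ℝ f = ∑ k, f k ∘ₗ symUpToProj g k := by
  refine DirectSum.linearMap_ext ℝ fun k => LinearMap.ext fun s => ?_
  rw [LinearMap.comp_apply, DirectSum.toModule_lof, LinearMap.comp_apply, LinearMap.sum_apply]
  exact (sum_proj_incl (symUpToIncl g) (symUpToProj g) symUpToProj_incl symUpToProj_incl_of_ne
    f k s).symm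

variable [FiniteDimensional ℝ g]
  (e : g ≃ₗ[ℝ] Module.Dual ℝ g) (he : ∀ x y, e x y = e y x)
  (hinv : ∀ X x y : g, e ⁅X, x⁆ y = - e x ⁅X, y⁆)
  {V ι : Type*} [AddCommGroup V] [Module ℝ V]
  [FiniteDimensional ℝ V] [LieRingModule g V] [LieModule ℝ g V]
  {H : Submodule ℝ g} {h₀ : g} {lam : ι → ℝ} {x : ι → g} (D : IsRootDecomposition H h₀ lam x)
  {Ω : Set (Module.Dual ℝ g)} {φ : Module.Dual ℝ g → Module.Dual ℝ V}
  (h : IsAlmostSeparating Ω φ p)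

include he hinv D h

theorem exists_isAlmostSeparating_dual_symUpTo :
    ∃ b : SymUpTo g p →ₗ⁅ℝ,g⁆ SymUpTo g p,
      IsAlmostSeparating (V := Module.Dual ℝ (SymUpTo g p)) Ω
        (fun ξ => Module.Dual.eval ℝ (SymUpTo g p) (b (symTau p (e.symm ξ)))) p :=
  exists_isAlmostSeparating_dual e he hinv (symUpToIncl g) (symUpToProj g) symUpToProj_incl
    symUpToProj_incl_of_ne lie_symUpToIncl symUpToProj_lie D h

theorem exists_isAlmostSeparating_symUpTo
    (θ : (k : Fin p) → SymPow g g (k + 1) ≃ₗ⁅ℝ,g⁆ Module.Dual ℝ (SymPow g g (k + 1))) :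
    ∃ b : (k : Fin p) → SymPow g g (k + 1) →ₗ⁅ℝ,g⁆ SymPow g g (k + 1),
      IsAlmostSeparating (V := SymUpTo g p) Ω
        (fun ξ => DirectSum.toModule ℝ (Fin p) ℝ
          (fun k => θ k (b k (symPower (k + 1) (e.symm ξ))))) p := by
  obtain ⟨b, hb⟩ := exists_isAlmostSeparating_of_selfDual e he hinv (symUpToIncl g) (symUpToProj g)
    symUpToProj_incl symUpToProj_incl_of_ne symUpToProj_lie D h θ
  refine ⟨b, ?_⟩
  simp only [toModule_eq_sum]
  exact hb

end SymUpTo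

/-! ### Split semisimple Lie algebras -/

section Split

open LieAlgebra LieAlgebra.IsKilling LieModule

/-- A split semisimple Lie algebra has a root decomposition: the element `h₀` of the Cartan
subalgebra is chosen outside of the kernels of all roots and of all differences of roots. -/
theorem exists_isRootDecomposition_of_isSplitLie.{u} (g : Type u) [LieRing g] [LieAlgebra ℝ g]
    [FiniteDimensional ℝ g] [LieAlgebra.IsSemisimple ℝ g] (hg : IsSplitLie g) :
    ∃ (ι : Type u) (H : Submodule ℝ g) (h₀ : g) (lam : ι → ℝ) (x : ι → g),
      IsRootDecomposition H h₀ lam x := by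
  obtain ⟨H, hH, hT⟩ := hg
  let ι := {α : Weight ℝ H g // α.IsNonZero}
  choose h e f t he hf using fun α : ι => exists_isSl2Triple_of_weight_isNonZero α.2
  let P := {q : ι × ι // q.1 ≠ q.2}
  let φ : ι ⊕ P → Module.Dual ℝ H := Sum.elim (fun α => Weight.toLinear ℝ H g α.1)
    (fun q => Weight.toLinear ℝ H g q.1.1.1 - Weight.toLinear ℝ H g q.1.2.1)
  obtain ⟨h₀, hh₀⟩ := Module.Dual.exists_forall_ne_zero_of_forall_exists φ (by
    rintro (α | q)
    · by_contra! hα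
      exact α.2 (funext hα)
    · by_contra! hq
      refine q.2 (Subtype.ext (Weight.ext fun z => ?_))
      exact sub_eq_zero.mp (hq z))
  have hroot : ∀ (α : ι) (y : g), y ∈ rootSpace H α.1 → ∃ c : ℝ, y = c • e α := by
    intro α y hy
    obtain ⟨c, hc⟩ := (finrank_eq_one_iff_of_nonzero' (⟨e α, he α⟩ : rootSpace H α.1)
      (fun h0 => (t α).e_ne_zero (congrArg Subtype.val h0))).mp
      (finrank_rootSpace_eq_one α.1 α.2) ⟨y, hy⟩
    exact ⟨c, (congrArg Subtype.val hc).symm⟩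
  refine ⟨ι, H.toSubmodule, h₀, fun α => α.1 h₀, e, ?_⟩
  refine ⟨h₀.2, fun a ha b hb => ?_, fun α => ?_, fun α => hh₀ (Sum.inl α), fun α β hαβ => ?_,
    ?_, fun α => ?_⟩
  · exact congrArg Subtype.val (trivial_lie_zero H H ⟨a, ha⟩ ⟨b, hb⟩)
  · exact lie_eq_smul_of_mem_rootSpace (he α) h₀
  · by_contra hne
    exact hh₀ (Sum.inr ⟨(α, β), hne⟩) (sub_eq_zero.mpr hαβ)
  · rw [eq_top_iff]
    have h1 := congrArg LieSubmodule.toSubmodule (iSup_genWeightSpace_eq_top' ℝ H g)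
    rw [LieSubmodule.iSup_toSubmodule, LieSubmodule.top_toSubmodule] at h1
    rw [← h1]
    refine iSup_le fun α => ?_
    by_cases hα : α.IsZero
    · refine le_trans ?_ le_sup_left
      intro y hy
      have h2 : y ∈ rootSpace H (α : H → ℝ) := hy
      rw [hα, rootSpace_zero_eq] at h2
      exact h2
    · refine le_trans ?_ le_sup_right
      intro y hy
      obtain ⟨c, rfl⟩ := hroot ⟨α, hα⟩ y hy
      exact Submodule.smul_mem _ _ (Submodule.subset_span ⟨_, rfl⟩)
  · let β : ι := ⟨-α.1, α.2.neg⟩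
    obtain ⟨c, hc⟩ := hroot β (f α) (hf α)
    have hh : h α ∈ H := by
      have := lie_mem_genWeightSpace_of_mem_genWeightSpace (he α) (hf α)
      rw [(t α).lie_e_f, add_neg_cancel, ← rootSpace, rootSpace_zero_eq] at this
      exact this
    exact ⟨β, c, h α, hh, hc ▸ t α⟩

end Split

/-! ### The Lie algebra of traceless matrices -/

section SpecialLinear

/-- The exponent of `3` in `3 ^ a + 3 ^ b` is `min a b`, since `1 + 3 ^ m` is prime to `3`. -/
theorem three_pow_add_three_pow_ne {a b c d : ℕ} (hab : a ≤ b) (hc : a < c) (hd : a < d) :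
    3 ^ a + 3 ^ b ≠ 3 ^ c + 3 ^ d := by
  intro h
  have h1 : 3 ^ (a + 1) ∣ 3 ^ c + 3 ^ d :=
    dvd_add (pow_dvd_pow 3 hc) (pow_dvd_pow 3 hd)
  obtain ⟨m, rfl⟩ := Nat.exists_eq_add_of_le hab
  rw [← h, pow_succ, pow_add, show 3 ^ a + 3 ^ a * 3 ^ m = 3 ^ a * (1 + 3 ^ m) by ring,
    Nat.mul_dvd_mul_iff_left (by positivity)] at h1
  rcases Nat.eq_zero_or_pos m with rfl | hm
  · norm_num at h1
  · have h2 : 3 ∣ 3 ^ m := dvd_pow_self 3 hm.ne'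
    omega

/-- The differences of distinct powers of three are pairwise distinct. -/
theorem three_pow_sub_injective {i j k l : ℕ} (hij : i ≠ j) (hkl : k ≠ l)
    (h : (3 : ℝ) ^ i - 3 ^ j = 3 ^ k - 3 ^ l) : i = k ∧ j = l := by
  have h1 : 3 ^ i + 3 ^ l = 3 ^ k + 3 ^ j := by
    have : (3 : ℝ) ^ i + 3 ^ l = 3 ^ k + 3 ^ j := by linarith
    exact_mod_cast this
  by_cases hik : i = k
  · subst hik
    exact ⟨rfl, (Nat.pow_right_injective (by norm_num : 2 ≤ 3)
      (Nat.add_left_cancel h1)).symm⟩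
  exfalso
  have hjl : j ≠ l := by
    rintro rfl
    exact hik (Nat.pow_right_injective (by norm_num : 2 ≤ 3) (Nat.add_right_cancel h1))
  have hmin : (i ≤ l ∧ i < k ∧ i < j) ∨ (l ≤ i ∧ l < k ∧ l < j) ∨ (k ≤ j ∧ k < i ∧ k < l) ∨
      (j ≤ k ∧ j < i ∧ j < l) := by omega
  rcases hmin with ⟨h2, h3, h4⟩ | ⟨h2, h3, h4⟩ | ⟨h2, h3, h4⟩ | ⟨h2, h3, h4⟩
  · exact three_pow_add_three_pow_ne h2 h3 h4 h1
  · exact three_pow_add_three_pow_ne h2 h3 h4 ((add_comm _ _).trans h1)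
  · exact three_pow_add_three_pow_ne h2 h3 h4 h1.symm
  · exact three_pow_add_three_pow_ne h2 h3 h4 ((add_comm _ _).trans h1.symm)

variable (n : ℕ)

/-- The diagonal matrix with entries `3 ^ i`, made traceless. -/
def slRegular : SL n :=
  ⟨Matrix.diagonal fun i : Fin n => (3 : ℝ) ^ (i : ℕ) - (∑ j : Fin n, (3 : ℝ) ^ (j : ℕ)) / n, by
    change Matrix.trace (Matrix.diagonal fun i : Fin n =>
      (3 : ℝ) ^ (i : ℕ) - (∑ j : Fin n, (3 : ℝ) ^ (j : ℕ)) / n) = 0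
    rw [Matrix.trace_diagonal, Finset.sum_sub_distrib, Finset.sum_const, Finset.card_univ,
      Fintype.card_fin, nsmul_eq_mul]
    rcases Nat.eq_zero_or_pos n with rfl | hn
    · simp
    · field_simp
      simp⟩

/-- The diagonal matrices in `sl(n, ℝ)`. -/
def slDiagonal : Submodule ℝ (SL n) where
  carrier := {A | ∀ i j, i ≠ j → A.1 i j = 0}
  add_mem' := fun {A B} hA hB i j hij => by
    change A.1 i j + B.1 i j = 0
    rw [hA i j hij, hB i j hij, add_zero]
  zero_mem' := fun _ _ _ => rfl
  smul_mem' := fun c A hA i j hij => by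
    change c * A.1 i j = 0
    rw [hA i j hij, mul_zero]

theorem exists_diagonal_of_mem_slDiagonal {A : SL n} (hA : A ∈ slDiagonal n) :
    A.1 = Matrix.diagonal fun i => A.1 i i := by
  ext i j
  by_cases hij : i = j
  · subst hij
    simp
  · rw [hA i j hij, Matrix.diagonal_apply_ne _ hij]

/-- The matrix units `E i j`, `i ≠ j`, are eigenvectors of `slRegular` with the pairwise distinct
eigenvalues `3 ^ i - 3 ^ j`. -/
theorem isRootDecomposition_sl : IsRootDecomposition (slDiagonal n) (slRegular n)
    (fun q : {q : Fin n × Fin n // q.1 ≠ q.2} => (3 : ℝ) ^ (q.1.1 : ℕ) - 3 ^ (q.1.2 : ℕ))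
    (fun q => LieAlgebra.SpecialLinear.single q.1.1 q.1.2 q.2 1) where
  mem := fun i j hij => Matrix.diagonal_apply_ne _ hij
  lie_eq_zero A hA B hB := by
    refine Subtype.ext ?_
    rw [LieAlgebra.SpecialLinear.sl_bracket, exists_diagonal_of_mem_slDiagonal n hA,
      exists_diagonal_of_mem_slDiagonal n hB, Matrix.diagonal_mul_diagonal,
      Matrix.diagonal_mul_diagonal]
    simp [mul_comm]
  lie_root q := by
    refine Subtype.ext ?_
    rw [LieAlgebra.SpecialLinear.sl_bracket]
    ext a b
    simp only [slRegular, LieAlgebra.SpecialLinear.val_single, Matrix.sub_apply,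
      Matrix.diagonal_mul, Matrix.mul_diagonal, Matrix.single_apply]
    change _ = _ * (LieAlgebra.SpecialLinear.single q.1.1 q.1.2 q.2 (1 : ℝ)).1 a b
    rw [LieAlgebra.SpecialLinear.val_single, Matrix.single_apply]
    split_ifs with h
    · rw [← h.1, ← h.2]
      ring
    · ring
  ne_zero q h := by
    have := Nat.pow_right_injective (by norm_num : 2 ≤ 3)
      (by exact_mod_cast sub_eq_zero.mp h : 3 ^ (q.1.1 : ℕ) = 3 ^ (q.1.2 : ℕ))
    exact q.2 (Fin.ext this)
  injective q r h := by
    obtain ⟨h1, h2⟩ := three_pow_sub_injective (fun h => q.2 (Fin.ext h))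
      (fun h => r.2 (Fin.ext h)) h
    exact Subtype.ext (Prod.ext (Fin.ext h1) (Fin.ext h2))
  sup_span := by
    rw [eq_top_iff]
    intro A _
    let x : {q : Fin n × Fin n // q.1 ≠ q.2} → SL n := fun q =>
      LieAlgebra.SpecialLinear.single q.1.1 q.1.2 q.2 1
    let B : SL n := ∑ q : {q : Fin n × Fin n // q.1 ≠ q.2}, A.1 q.1.1 q.1.2 • x q
    have hB : B ∈ Submodule.span ℝ (Set.range x) :=
      Submodule.sum_mem _ fun q _ => Submodule.smul_mem _ _ (Submodule.subset_span ⟨q, rfl⟩)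
    refine Submodule.mem_sup.mpr ⟨A - B, fun i j hij => ?_, B, hB, sub_add_cancel _ _⟩
    have h1 : B.1 i j = A.1 i j := by
      have h2 : B.1 = ∑ q : {q : Fin n × Fin n // q.1 ≠ q.2},
          A.1 q.1.1 q.1.2 • (x q).1 := by
        exact map_sum (⟨⟨fun A => A.1, rfl⟩, fun _ _ => rfl⟩ :
          SL n →+ Matrix (Fin n) (Fin n) ℝ) _ _
      rw [h2, Matrix.sum_apply, Finset.sum_eq_single ⟨(i, j), hij⟩]
      · simp [x]
      · intro q _ hq
        have h3 : ¬ (q.1.1 = i ∧ q.1.2 = j) := fun h => hq (Subtype.ext (Prod.ext h.1 h.2))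
        simp [x, h3]
      · simp
    change A.1 i j - B.1 i j = 0
    rw [h1, sub_self]
  sl2 q := by
    obtain ⟨⟨i, j⟩, hij⟩ := q
    replace hij : i ≠ j := hij
    refine ⟨⟨(j, i), hij.symm⟩, 1, LieAlgebra.SpecialLinear.singleSubSingle i j 1,
      fun a b hab => ?_, ?_, ?_, ?_, ?_⟩
    · change (Matrix.single i i (1 : ℝ) - Matrix.single j j 1 : Matrix (Fin n) (Fin n) ℝ) a b = 0
      rw [Matrix.sub_apply, Matrix.single_apply, Matrix.single_apply, if_neg, if_neg, sub_zero]
      · rintro ⟨rfl, rfl⟩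
        exact hab rfl
      · rintro ⟨rfl, rfl⟩
        exact hab rfl
    · intro h0
      have h1 : (Matrix.single i i (1 : ℝ) - Matrix.single j j 1 :
          Matrix (Fin n) (Fin n) ℝ) i i = 0 :=
        congrArg (fun A : SL n => A.1 i i) h0
      simp [hij.symm] at h1
    · refine Subtype.ext ?_
      rw [one_smul, LieAlgebra.SpecialLinear.sl_bracket]
      simp
    · refine Subtype.ext ?_
      rw [LieAlgebra.SpecialLinear.sl_bracket, two_smul]
      change _ = Matrix.single i j (1 : ℝ) + Matrix.single i j 1
      simp [sub_mul, mul_sub, Matrix.single_mul_single_of_ne, hij.symm]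
    · refine Subtype.ext ?_
      rw [one_smul, LieAlgebra.SpecialLinear.sl_bracket, two_smul]
      change _ = -(Matrix.single j i (1 : ℝ) + Matrix.single j i 1)
      simp [sub_mul, mul_sub, Matrix.single_mul_single_of_ne, hij]
      abel

end SpecialLinear

/-! ### Proof of the theorem -/

section Conclusion

theorem killingEquiv_apply (g : Type*) [LieRing g] [LieAlgebra ℝ g] [FiniteDimensional ℝ g]
    [LieAlgebra.IsSemisimple ℝ g] (x y : g) : killingEquiv g x y = killingForm ℝ g x y := rfl

theorem slTraceEquiv_apply (n : ℕ) (A B : SL n) :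
    slTraceEquiv n A B = Matrix.trace (A.1 * B.1) := rfl

theorem slTraceEquiv_comm (n : ℕ) (A B : SL n) : slTraceEquiv n A B = slTraceEquiv n B A := by
  rw [slTraceEquiv_apply, slTraceEquiv_apply, Matrix.trace_mul_comm]

theorem slTraceEquiv_lie (n : ℕ) (X A B : SL n) :
    slTraceEquiv n ⁅X, A⁆ B = -slTraceEquiv n A ⁅X, B⁆ := by
  rw [slTraceEquiv_apply, slTraceEquiv_apply, LieAlgebra.SpecialLinear.sl_bracket,
    LieAlgebra.SpecialLinear.sl_bracket, sub_mul, mul_sub, Matrix.trace_sub, Matrix.trace_sub,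
    Matrix.mul_assoc A.1 X.1 B.1, ← Matrix.mul_assoc A.1 B.1 X.1,
    Matrix.trace_mul_comm (A.1 * B.1) X.1, Matrix.mul_assoc X.1 A.1 B.1]
  ring

/-- An invariant symmetric nondegenerate form makes the symmetric powers self-dual modules. -/
theorem nonempty_symPow_equiv_dual {g : Type*} [LieRing g] [LieAlgebra ℝ g] [FiniteDimensional ℝ g]
    (e : g ≃ₗ[ℝ] Module.Dual ℝ g) (he : ∀ x y, e x y = e y x)
    (hinv : ∀ X x y : g, e ⁅X, x⁆ y = -e x ⁅X, y⁆) (k : ℕ) :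
    Nonempty (SymPow g g k ≃ₗ⁅ℝ,g⁆ Module.Dual ℝ (SymPow g g k)) :=
  ⟨{ symPowDual e he k with
      map_lie' := fun {X s} => LinearMap.ext fun w => by
        change symPowDual e he k ⁅X, s⁆ w = (⁅X, symPowDual e he k s⁆ : Module.Dual ℝ _) w
        rw [symPowDual_lie e he hinv, Module.Dual.lie_apply] }⟩

theorem corollary4p4 :
    (∀ (g : Type*) [LieRing g] [LieAlgebra ℝ g] [FiniteDimensional ℝ g]
        [LieAlgebra.IsSemisimple ℝ g], IsSplitLie g →
      ∀ (p : ℕ) (V : Type*) [AddCommGroup V] [Module ℝ V] [FiniteDimensional ℝ V]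
        [LieRingModule g V] [LieModule ℝ g V] (φ : Module.Dual ℝ g → Module.Dual ℝ V),
        IsAlmostSeparating (genericSet g) φ p →
        ∃ b : SymUpTo g p →ₗ⁅ℝ,g⁆ SymUpTo g p,
          IsAlmostSeparating (V := Module.Dual ℝ (SymUpTo g p)) (genericSet g)
            (fun ξ => Module.Dual.eval ℝ (SymUpTo g p)
              (b (symTau p ((killingEquiv g).symm ξ)))) p) ∧
    (∀ n : ℕ,
      (∀ k : ℕ, Nonempty (SymPow (SL n) (SL n) k ≃ₗ⁅ℝ,SL n⁆
        Module.Dual ℝ (SymPow (SL n) (SL n) k))) ∧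
      ∀ (p : ℕ) (V : Type*) [AddCommGroup V] [Module ℝ V] [FiniteDimensional ℝ V]
        [LieRingModule (SL n) V] [LieModule ℝ (SL n) V]
        (φ : Module.Dual ℝ (SL n) → Module.Dual ℝ V),
        IsAlmostSeparating (slGenericSet n) φ p →
        ∀ θ : (k : Fin p) → SymPow (SL n) (SL n) (k + 1) ≃ₗ⁅ℝ,SL n⁆
            Module.Dual ℝ (SymPow (SL n) (SL n) (k + 1)),
        ∃ b : (k : Fin p) → SymPow (SL n) (SL n) (k + 1) →ₗ⁅ℝ,SL n⁆
            SymPow (SL n) (SL n) (k + 1),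
          IsAlmostSeparating (V := SymUpTo (SL n) p) (slGenericSet n)
            (fun ξ => DirectSum.toModule ℝ (Fin p) ℝ
              (fun k => θ k (b k (symPower (k + 1) ((slTraceEquiv n).symm ξ))))) p) := by
  refine ⟨fun g _ _ _ _ hg p V _ _ _ _ _ φ h => ?_, fun n => ⟨fun k =>
    nonempty_symPow_equiv_dual (slTraceEquiv n) (slTraceEquiv_comm n) (slTraceEquiv_lie n) k,
    fun p V _ _ _ _ _ φ h θ => ?_⟩⟩
  · obtain ⟨ι, H, h₀, lam, x, D⟩ := exists_isRootDecomposition_of_isSplitLie g hg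
    refine exists_isAlmostSeparating_dual_symUpTo (killingEquiv g)
      (fun x y => LieModule.traceForm_comm ℝ g g x y) (fun X x y => ?_) D h
    rw [killingEquiv_apply, killingEquiv_apply, ← lie_skew, map_neg, LinearMap.neg_apply,
      killingForm, LieModule.traceForm_apply_lie_apply]
  · exact exists_isAlmostSeparating_symUpTo (slTraceEquiv n) (slTraceEquiv_comm n)
      (slTraceEquiv_lie n) (isRootDecomposition_sl n) h θ

end Conclusion

end
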